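/- For a smooth immersed planar curve $\gamma$ let $s$ denote arc length, $\tau=\partial_s\gamma$ the unit tangent, $\nu$ the unit normal obtained by rotating $\tau$ anticlockwise by $\pi/2$, and $k$ the signed curvature, $\partial_s\tau=k\nu$. A family of closed immersed curves $\gamma(\cdot,t)$ moves by the free elastic flow (the $L^2(ds)$-gradient flow of $\frac12\int k^2\,ds$) if its normal velocity satisfies $\langle\partial_t\gamma,\nu\rangle=-\bigl(k_{ss}+\tfrac12k^3\bigr)$. Theorem. There is an integer $m_0<\infty$ and, for every integer $m>m_0$, a smooth closed immersed planar curve $\gamma_m:\mathbb S^1\to\mathbb R^2$ (a "jellyfish") such that: (i) $\gamma_m$ is a homothetic expander for the free elastic flow: there is $\sigma>0$ with $k_{ss}+\tfrac12k^3=-\sigma\langle\gamma_m,\nu\rangle$ along $\gamma_m$, and there is a strictly increasing $\rho:[0,\infty)\to[1,\infty)$ with $\rho(0)=1$ and $\rho(t)\to\infty$ as $t\to\infty$ such that $\gamma(\cdot,t)=\rho(t)\gamma_m$, $t\ge0$, is a smooth solution of the free elastic flow; (ii) $\gamma_m$ has dihedral symmetry of order $m$: the group of all isometries of $\mathbb R^2$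 that map the image of $\gamma_m$ onto itself is exactly a dihedral group $D_m$ of order $2m$ centred at the origin, generated by the rotation through $2\pi/m$ about the origin and the reflection across some line through the origin; (iii) if $m,\hat m>m_0$ and $m\ne\hat m$, no similarity transformation of $\mathbb R^2$ maps the image of $\gamma_m$ onto the image of $\gamma_{\hat m}$. -/

import Mathlib

/-! Planar curves are maps `ℝ → ℂ`, where `ℂ` is the Euclidean plane; a closed curve is a
periodic map, that is a map on a circle `ℝ / Tℤ`. -/

/-- A smooth closed immersed planar curve. -/
structure IsSmoothClosedImmersedCurve (γ : ℝ → ℂ) : Prop where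
  smooth : ContDiff ℝ (⊤ : ℕ∞) γ
  closed : ∃ T : ℝ, 0 < T ∧ Function.Periodic γ T
  immersed : ∀ u, deriv γ u ≠ 0

/-- The derivative `∂_s f` with respect to arc length along `γ`. -/
noncomputable def arcDeriv {E : Type*} [NormedAddCommGroup E] [NormedSpace ℝ E]
    (γ : ℝ → ℂ) (f : ℝ → E) (u : ℝ) : E :=
  ‖deriv γ u‖⁻¹ • deriv f u

/-- The unit tangent `τ = ∂_s γ`. -/
noncomputable def unitTangent (γ : ℝ → ℂ) : ℝ → ℂ :=
  arcDeriv γ γ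

/-- The unit normal `ν`: the unit tangent rotated by a quarter turn anticlockwise. -/
noncomputable def unitNormal (γ : ℝ → ℂ) (u : ℝ) : ℂ :=
  Complex.I * unitTangent γ u

/-- The signed curvature `k`, determined by `∂_s τ = k ν`. -/
noncomputable def curvature (γ : ℝ → ℂ) (u : ℝ) : ℝ :=
  inner ℝ (arcDeriv γ (unitTangent γ) u) (unitNormal γ u)

/-- The `L²(ds)`-gradient `k_ss + k³ / 2` of the elastic energy `½ ∫ k² ds`
(the coefficient of the normal `ν`). -/
noncomputable def elasticGradient (γ : ℝ → ℂ) (u : ℝ) : ℝ :=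
  arcDeriv γ (arcDeriv γ (curvature γ)) u + (1 / 2) * curvature γ u ^ 3

/-- `F t`, for `0 ≤ t < ∞`, is a smooth family of closed immersed curves that moves by the free
elastic flow: the normal velocity of `F` is `-(k_ss + k³ / 2)`. -/
structure IsElasticFlow (F : ℝ → ℝ → ℂ) : Prop where
  smooth : ContDiffOn ℝ (⊤ : ℕ∞) (fun p : ℝ × ℝ => F p.1 p.2) (Set.Ici 0 ×ˢ Set.univ)
  closed : ∃ T : ℝ, 0 < T ∧ ∀ t, 0 ≤ t → Function.Periodic (F t) T
  immersed : ∀ t, 0 ≤ t → ∀ u, deriv (F t) u ≠ 0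
  normal_velocity : ∀ t, 0 ≤ t → ∀ u, ∃ V : ℂ,
    HasDerivWithinAt (fun t' => F t' u) V (Set.Ici 0) t ∧
      inner ℝ V (unitNormal (F t) u) = -elasticGradient (F t) u

/-- `γ` is (the profile of) a homothetic expander of the free elastic flow, with centre of
expansion `0`: it solves `k_ss + k³ / 2 = -σ ⟨γ, ν⟩` with some `σ > 0`, and the flow started at `γ`
is `t ↦ ρ(t) γ` with a factor `ρ` that increases strictly from `1` to infinity. -/
def IsHomotheticExpander (γ : ℝ → ℂ) : Prop :=
  (∃ σ : ℝ, 0 < σ ∧ ∀ u, elasticGradient γ u = -σ * inner ℝ (γ u) (unitNormal γ u)) ∧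
    ∃ ρ : ℝ → ℝ, ρ 0 = 1 ∧ StrictMonoOn ρ (Set.Ici 0) ∧
      Filter.Tendsto ρ Filter.atTop Filter.atTop ∧
        IsElasticFlow (fun t u => (ρ t : ℂ) * γ u)

/-- The group of all isometries of the plane that map the set `Γ` onto itself. -/
def planeSymmetryGroup (Γ : Set ℂ) : Subgroup (ℂ ≃ᵢ ℂ) where
  carrier := {Φ | Φ '' Γ = Γ}
  one_mem' := by simp
  mul_mem' := by
    intro Φ Ψ hΦ hΨ
    simp only [Set.mem_ofPred_eq] at hΦ hΨ ⊢
    rw [IsometryEquiv.coe_mul, Set.image_comp, hΨ, hΦ]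
  inv_mem' := by
    intro Φ hΦ
    simp only [Set.mem_ofPred_eq] at hΦ ⊢
    conv_lhs => rw [← hΦ]
    rw [← Set.image_comp, ← IsometryEquiv.coe_mul]
    simp

/-- The reflection `z ↦ a² z̄` across the line `ℝ a`, where `|a| = 1`. -/
noncomputable def lineReflection (a : Circle) : ℂ ≃ₗᵢ[ℝ] ℂ :=
  Complex.conjLIE.trans (rotation (a ^ 2))

/-- The dihedral group of order `2 m` centred at `0`: it is generated by the rotation through
`2 π / m` and by the reflection across the line `ℝ a`. -/
noncomputable def dihedralSubgroup (m : ℕ) (a : Circle) : Subgroup (ℂ ≃ᵢ ℂ) :=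
  Subgroup.closure
    {(rotation (Circle.exp (2 * Real.pi / m))).toIsometryEquiv,
      (lineReflection a).toIsometryEquiv}

/-- `Γ` has dihedral symmetry of order `m` about `0`: its full symmetry group is the dihedral group
with `m` rotations and `m` reflections. -/
def HasDihedralSymmetry (m : ℕ) (Γ : Set ℂ) : Prop :=
  ∃ a : Circle, planeSymmetryGroup Γ = dihedralSubgroup m a

/-- Two sets of the plane are equivalent by a similarity transformation (an arbitrary composition
of dilations, rotations, reflections and translations). -/
def AreSimilar (Γ Γ' : Set ℂ) : Prop :=
  ∃ Φ : ℂ ≃ᵈ ℂ, Φ '' Γ = Γ'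

/-! The curves are found by shooting from a degenerate limit. With `P = δ γ` and `σ = ε δ`, the
expander equation becomes an autonomous system for `u = ⟨P, τ⟩`, `v = ⟨P, ν⟩`, `k` and `a = k'`,
with constant parameters `p = (ε, δ)`. At `p = 0` the point `P` does not move (the centre is
infinitely far away on the scale of the curvature), and `k` is the curvature of the rectangular
elastica, whose tangent turns by total angle zero over a half period.

The system is reversible: at a time where `u = a = 0` the curve crosses a line of reflection. Time
`0` is such a time. If `l` is another one, the two reflections generate the rotation through `2 Θ`,
where `Θ = ∫ k` over `[0, l]`, and `Θ = -π / m` makes the curve close up. The time `l` comes from `a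
= 0`, since `a` has positive slope there. Two identities give the other conditions: `k² u / 2 + a v`
has derivative `δ k² / 2 - ε v²`, and with `θ' = k`, `θ 0 = 0`, the first coordinate `u cos θ - v
sin θ` of `P` has derivative `δ cos θ`. Hence `u(l) = 0` amounts to `δ A = ε B`, and then `sin Θ =
-t` amounts to `δ X = t v(l)`, where `A`, `B`, `X` are integrals that are positive at `p = 0`. These
equations read `p = t • h p` with `h` Lipschitz near `0`, so a contraction solves them for small `t
= sin (π / m)`; see `eventually_exists_half_period`.

Since `|P|²` has derivative `2 δ u` and `u > 0` on `(0, l)`, the points farthest from the origin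
form one orbit of the rotation. This determines the symmetry group (`isometry_eq_of_image_eq`), and
the orders of its elements distinguish different `m` up to similarity. -/

/-! ### Global solutions of bounded Lipschitz fields -/

theorem exists_global_solution_of_lipschitzWith_of_bounded {E : Type*} [NormedAddCommGroup E]
    [NormedSpace ℝ E] [CompleteSpace E] {v : E → E} {K L : NNReal} (hK : LipschitzWith K v)
    (hL : ∀ x, ‖v x‖ ≤ L) (x₀ : E) :
    ∃ z : ℝ → E, z 0 = x₀ ∧ ∀ t, HasDerivAt z (v (z t)) t := by
  have key : ∀ n : ℕ, ∃ z : ℝ → E, z 0 = x₀ ∧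
      ∀ t ∈ Set.Ioo (-(n + 1 : ℝ)) (n + 1), HasDerivAt z (v (z t)) t := by
    intro n
    have h0 : (0 : ℝ) ∈ Set.Icc (-(n + 1 : ℝ)) (n + 1) := ⟨by linarith, by positivity⟩
    -- A field of norm at most `L` moves a point by at most `L (n + 1)` in time `n + 1`, so the ball
    -- of that radius works on an interval of any length.
    have hpl : IsPicardLindelof (fun _ => v) (⟨0, h0⟩ : Set.Icc (-(n + 1 : ℝ)) (n + 1)) x₀
        (L * (n + 1)) 0 L K :=
      { lipschitzOnWith := fun _ _ => hK.lipschitzOnWith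
        continuousOn := fun _ _ => continuousOn_const
        norm_le := fun _ _ x _ => hL x
        mul_max_le := by simp }
    obtain ⟨z, hz0, hz⟩ := hpl.exists_eq_forall_mem_Icc_hasDerivWithinAt₀
    exact ⟨z, hz0, fun t ht => (hz t (Set.Ioo_subset_Icc_self ht)).hasDerivAt
      (Icc_mem_nhds ht.1 ht.2)⟩
  choose z hz0 hz using key
  have agree : ∀ n m : ℕ, n ≤ m → ∀ t ∈ Set.Ioo (-(n + 1 : ℝ)) (n + 1), z n t = z m t := by
    intro n m hnm t ht
    have hnm' : (n : ℝ) ≤ m := by exact_mod_cast hnm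
    refine ODE_solution_unique_of_mem_Ioo (v := fun _ => v) (s := fun _ => Set.univ) (K := K)
      (t₀ := 0) (fun _ _ => hK.lipschitzOnWith) ⟨by linarith, by positivity⟩
      (fun s hs => ⟨hz n s hs, trivial⟩)
      (fun s hs => ⟨hz m s ⟨by linarith [hs.1], by linarith [hs.2]⟩, trivial⟩)
      (by rw [hz0, hz0]) ht
  refine ⟨fun t => z ⌈|t|⌉₊ t, by simp [hz0], fun t => ?_⟩
  -- The extra `1` makes the single solution `z n` serve for all times close to `t`.
  set n := ⌈|t|⌉₊ + 1 with hn
  have hceil : |t| ≤ ⌈|t|⌉₊ := Nat.le_ceil _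
  have hmem : ∀ s : ℝ, s ∈ Set.Ioo (-(⌈|s|⌉₊ + 1 : ℝ)) (⌈|s|⌉₊ + 1) := by
    intro s
    have h1 : |s| ≤ ⌈|s|⌉₊ := Nat.le_ceil _
    constructor <;> linarith [neg_abs_le s, le_abs_self s]
  have hev : (fun s => z ⌈|s|⌉₊ s) =ᶠ[nhds t] z n := by
    have : ∀ᶠ s in nhds t, |s| < |t| + 1 :=
      (continuous_abs.tendsto t).eventually (gt_mem_nhds (lt_add_one _))
    filter_upwards [this] with s hs
    refine agree _ _ ?_ s (hmem s)
    rw [Nat.ceil_le, hn]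
    push_cast
    linarith
  have h2 : HasDerivAt (z n) (v (z n t)) t := by
    refine hz n t ?_
    rw [hn]
    push_cast
    constructor <;> linarith [neg_abs_le t, le_abs_self t]
  have h3 : z ⌈|t|⌉₊ t = z n t := agree _ _ (Nat.le_succ _) t (hmem t)
  beta_reduce
  rw [h3]
  exact h2.congr_of_eventuallyEq hev

theorem eq_of_hasDerivAt_of_lipschitzWith {E : Type*} [NormedAddCommGroup E] [NormedSpace ℝ E]
    {v : E → E} {K : NNReal} (hK : LipschitzWith K v) {y z : ℝ → E} {t₀ : ℝ}
    (hy : ∀ t, HasDerivAt y (v (y t)) t) (hz : ∀ t, HasDerivAt z (v (z t)) t)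
    (h : y t₀ = z t₀) : y = z :=
  ODE_solution_unique_univ (v := fun _ => v) (s := fun _ => Set.univ)
    (fun _ => hK.lipschitzOnWith) (fun t => ⟨hy t, trivial⟩) (fun t => ⟨hz t, trivial⟩) h

theorem dist_le_mul_exp_of_hasDerivAt {E : Type*} [NormedAddCommGroup E] [NormedSpace ℝ E]
    {v : E → E} {K : NNReal} (hK : LipschitzWith K v) {y z : ℝ → E}
    (hy : ∀ t, HasDerivAt y (v (y t)) t) (hz : ∀ t, HasDerivAt z (v (z t)) t)
    {t : ℝ} (ht : 0 ≤ t) : dist (y t) (z t) ≤ dist (y 0) (z 0) * Real.exp (K * t) := by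
  have := dist_le_of_trajectories_ODE (v := fun _ => v) (K := K) (f := y) (g := z) (a := 0) (b := t)
    (fun _ => hK) (fun s _ => (hy s).continuousAt.continuousWithinAt)
    (fun s _ => (hy s).hasDerivWithinAt) (fun s _ => (hz s).continuousAt.continuousWithinAt)
    (fun s _ => (hz s).hasDerivWithinAt) le_rfl t ⟨ht, le_rfl⟩
  simpa using this

/-! ### Truncation to a cube -/

/-- The truncation of a real number to the interval `[-2, 2]`. -/
noncomputable def clip (x : ℝ) : ℝ := max (-2) (min 2 x)

theorem clip_of_abs_le {x : ℝ} (h : |x| ≤ 2) : clip x = x := by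
  rw [abs_le] at h
  simp [clip, h.1, h.2]

theorem abs_clip_le (x : ℝ) : |clip x| ≤ 2 := by
  rw [abs_le]
  exact ⟨le_max_left _ _, max_le (by norm_num) (min_le_left _ _)⟩

theorem clip_neg (x : ℝ) : clip (-x) = -clip x := by
  unfold clip
  grind

theorem lipschitzWith_clip : LipschitzWith 1 clip :=
  (LipschitzWith.id.const_min 2).const_max (-2)

theorem continuous_clip : Continuous clip := lipschitzWith_clip.continuous

theorem lipschitzWith_pi_clip {n : ℕ} :
    LipschitzWith 1 (fun (x : Fin n → ℝ) i => clip (x i)) :=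
  LipschitzWith.of_dist_le_mul fun x y => by
    simp only [NNReal.coe_one, one_mul]
    refine (dist_pi_le_iff dist_nonneg).2 fun i => ?_
    refine (lipschitzWith_clip.dist_le_mul _ _).trans ?_
    simpa using dist_le_pi_dist x y i

/-- On the compact convex cube the derivative of `w` is bounded, and the truncation is a 1-Lipschitz
map into the cube. -/
theorem exists_lipschitzWith_comp_clip {n : ℕ} {w : (Fin n → ℝ) → (Fin n → ℝ)}
    (hw : ContDiff ℝ 1 w) :
    ∃ K L : NNReal, LipschitzWith K (fun x : Fin n → ℝ => w (fun i => clip (x i))) ∧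
      ∀ x : Fin n → ℝ, ‖w (fun i => clip (x i))‖ ≤ L := by
  let S : Set (Fin n → ℝ) := Set.Icc (fun _ => -2) (fun _ => 2)
  have hS : IsCompact S := isCompact_Icc
  have hmem : ∀ x : Fin n → ℝ, (fun i => clip (x i)) ∈ S := fun x =>
    ⟨fun i => (abs_le.1 (abs_clip_le (x i))).1, fun i => (abs_le.1 (abs_clip_le (x i))).2⟩
  obtain ⟨K, hK⟩ := hS.exists_bound_of_continuousOn
    (hw.continuous_fderiv one_ne_zero).continuousOn
  obtain ⟨L, hL⟩ := hS.exists_bound_of_continuousOn hw.continuous.continuousOn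
  have hlip : LipschitzOnWith K.toNNReal w S := by
    refine (convex_Icc _ _).lipschitzOnWith_of_nnnorm_fderiv_le
      (fun x _ => (hw.differentiable one_ne_zero) x) fun x hx => ?_
    rw [← NNReal.coe_le_coe, coe_nnnorm]
    exact (hK x hx).trans (Real.le_coe_toNNReal K)
  refine ⟨K.toNNReal * 1, L.toNNReal, ?_, fun x => (hL _ (hmem x)).trans (Real.le_coe_toNNReal L)⟩
  rw [← lipschitzOnWith_univ]
  exact hlip.comp lipschitzWith_pi_clip.lipschitzOnWith fun x _ => hmem x

/-! ### The moving-frame system and its flow -/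

/-- For a curve with position `P`, where `P' = δ τ`, and with curvature `k`, where
`k'' + k³ / 2 = - ε ⟨P, ν⟩`, this is the vector field that drives
`(⟨P, τ⟩, ⟨P, ν⟩, k, k', ε, δ)`. -/
noncomputable def frameField (x : Fin 6 → ℝ) : Fin 6 → ℝ :=
  ![x 5 + x 2 * x 1, -(x 2 * x 0), x 3, -(x 2 ^ 3 / 2) - x 4 * x 1, 0, 0]

/-- The vector field `frameField`, made bounded. -/
noncomputable def clippedField (x : Fin 6 → ℝ) : Fin 6 → ℝ :=
  frameField fun i => clip (x i)

theorem contDiff_frameField : ContDiff ℝ 1 frameField := by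
  rw [contDiff_pi]
  intro i
  fin_cases i <;> simp [frameField] <;> fun_prop

theorem exists_lipschitzWith_clippedField :
    ∃ K L : NNReal, LipschitzWith K clippedField ∧ ∀ x, ‖clippedField x‖ ≤ L :=
  exists_lipschitzWith_comp_clip contDiff_frameField

/-- The flow of `clippedField`. -/
noncomputable def flow (x : Fin 6 → ℝ) : ℝ → Fin 6 → ℝ :=
  (exists_global_solution_of_lipschitzWith_of_bounded
    exists_lipschitzWith_clippedField.choose_spec.choose_spec.1
    exists_lipschitzWith_clippedField.choose_spec.choose_spec.2 x).choose

theorem flow_zero (x : Fin 6 → ℝ) : flow x 0 = x :=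
  (exists_global_solution_of_lipschitzWith_of_bounded
    exists_lipschitzWith_clippedField.choose_spec.choose_spec.1
    exists_lipschitzWith_clippedField.choose_spec.choose_spec.2 x).choose_spec.1

theorem hasDerivAt_flow (x : Fin 6 → ℝ) (t : ℝ) :
    HasDerivAt (flow x) (clippedField (flow x t)) t :=
  (exists_global_solution_of_lipschitzWith_of_bounded
    exists_lipschitzWith_clippedField.choose_spec.choose_spec.1
    exists_lipschitzWith_clippedField.choose_spec.choose_spec.2 x).choose_spec.2 t

theorem eq_flow_of_hasDerivAt {y : ℝ → Fin 6 → ℝ}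
    (hy : ∀ t, HasDerivAt y (clippedField (y t)) t) {x : Fin 6 → ℝ} {t₀ : ℝ}
    (h : y t₀ = flow x t₀) : y = flow x := by
  obtain ⟨K, L, hK, -⟩ := exists_lipschitzWith_clippedField
  exact eq_of_hasDerivAt_of_lipschitzWith hK hy (hasDerivAt_flow x) h

theorem hasDerivAt_flow_apply (x : Fin 6 → ℝ) (t : ℝ) (i : Fin 6) :
    HasDerivAt (fun s => flow x s i) (clippedField (flow x t) i) t :=
  hasDerivAt_pi.1 (hasDerivAt_flow x t) i

theorem continuous_flow (x : Fin 6 → ℝ) : Continuous (flow x) :=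
  continuous_iff_continuousAt.2 fun t => (hasDerivAt_flow x t).continuousAt

theorem flow_apply_four (x : Fin 6 → ℝ) (t : ℝ) : flow x t 4 = x 4 := by
  have h := is_const_of_deriv_eq_zero (f := fun s => flow x s 4)
    (fun t => (hasDerivAt_flow_apply x t 4).differentiableAt)
    (fun t => by rw [(hasDerivAt_flow_apply x t 4).deriv]; simp [clippedField, frameField]) t 0
  simpa [flow_zero] using h

theorem flow_apply_five (x : Fin 6 → ℝ) (t : ℝ) : flow x t 5 = x 5 := by
  have h := is_const_of_deriv_eq_zero (f := fun s => flow x s 5)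
    (fun t => (hasDerivAt_flow_apply x t 5).differentiableAt)
    (fun t => by rw [(hasDerivAt_flow_apply x t 5).deriv]; simp [clippedField, frameField]) t 0
  simpa [flow_zero] using h

/-! ### The rectangular elastica, the limit `ε = δ = 0` -/

/-- The primitive of an odd function that is positive on the positive axis is even and increases
with `|x|`. It turns conservation of energy into pointwise bounds. -/
theorem abs_le_of_integral_le {g : ℝ → ℝ} (hg : Continuous g) (hodd : ∀ x, g (-x) = -g x)
    (hpos : ∀ x, 0 < x → 0 < g x) {x y : ℝ} (hy : 0 ≤ y)
    (h : ∫ s in 0..x, g s ≤ ∫ s in 0..y, g s) : |x| ≤ y := by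
  have hint : ∀ a b, IntervalIntegrable g MeasureTheory.volume a b := hg.intervalIntegrable
  have key : ∀ x, (∫ s in 0..x, g s) ≤ ∫ s in 0..y, g s → x ≤ y := by
    intro x hx
    by_contra! hlt
    have h1 := intervalIntegral.integral_add_adjacent_intervals (hint 0 y) (hint y x)
    have h2 : 0 < ∫ s in y..x, g s :=
      intervalIntegral.intervalIntegral_pos_of_pos_on (hint y x)
        (fun s hs => hpos s (hy.trans_lt hs.1)) hlt
    linarith
  refine abs_le'.2 ⟨key x h, key (-x) ?_⟩
  have h1 : ∫ s in 0..(-x), g s = ∫ s in 0..x, g s := by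
    have := intervalIntegral.integral_comp_neg (a := 0) (b := x) g
    simp only [hodd, intervalIntegral.integral_neg, neg_zero] at this
    rw [intervalIntegral.integral_symm, ← this, neg_neg]
  rw [h1]
  exact h

/-- The initial value: the curve starts with curvature `1` at distance `1` from the centre, and its
tangent is orthogonal to the position vector. -/
noncomputable def initialValue (p : ℝ × ℝ) : Fin 6 → ℝ := ![0, 1, 1, 0, p.1, p.2]

/-- For `δ = 0` the frame coordinates of the fixed point `P` satisfy `u' = k v`, `v' = -k u`, which
`(-2 a, k²)` solves. The bounds keep the solution in the cube, where truncation does nothing. -/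
theorem hasDerivAt_elastica_frame {k a : ℝ → ℝ} (hk : ∀ t, HasDerivAt k (a t) t)
    (ha : ∀ t, HasDerivAt a (-(k t ^ 3 / 2)) t) (hk1 : ∀ t, |k t| ≤ 1) (ha1 : ∀ t, |a t| ≤ 1 / 2)
    (t : ℝ) :
    HasDerivAt (fun s => (![-2 * a s, k s ^ 2, k s, a s, 0, 0] : Fin 6 → ℝ))
      (clippedField ![-2 * a t, k t ^ 2, k t, a t, 0, 0]) t := by
  have c0 : clip (-2 * a t) = -2 * a t := by
    apply clip_of_abs_le
    rw [abs_mul]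
    norm_num
    linarith [ha1 t]
  have c1 : clip (k t ^ 2) = k t ^ 2 := by
    apply clip_of_abs_le
    rw [abs_pow]
    have := hk1 t
    nlinarith [abs_nonneg (k t)]
  have c2 : clip (k t) = k t := clip_of_abs_le ((hk1 t).trans (by norm_num))
  have c3 : clip (a t) = a t := clip_of_abs_le ((ha1 t).trans (by norm_num))
  have c4 : clip 0 = 0 := clip_of_abs_le (by norm_num)
  rw [hasDerivAt_pi]
  intro i
  fin_cases i <;> simp [clippedField, frameField, c1, c2, c3, c4]
  · exact ((ha t).const_mul 2).fun_neg.congr_deriv (by ring)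
  · rw [show -(2 * a t) = -2 * a t by ring, c0]
    exact ((hk t).fun_pow 2).congr_deriv (by push_cast; ring)
  · exact hk t
  · exact ha t
  · exact hasDerivAt_const _ _
  · exact hasDerivAt_const _ _

theorem exists_elastica : ∃ k a : ℝ → ℝ, (∀ t, HasDerivAt k (a t) t) ∧
    (∀ t, HasDerivAt a (-(k t ^ 3 / 2)) t) ∧ (∀ t, |k t| ≤ 1) ∧ (∀ t, |a t| ≤ 1 / 2) ∧
    (∀ t, 4 * a t ^ 2 + k t ^ 4 = 1) ∧ k 0 = 1 ∧ a 0 = 0 ∧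
    flow (initialValue 0) = fun s => ![-2 * a s, k s ^ 2, k s, a s, 0, 0] := by
  set z := flow (initialValue 0) with hz
  have c4 : clip 0 = 0 := clip_of_abs_le (by norm_num)
  have h4 : ∀ t, z t 4 = 0 := fun t => by
    rw [hz, flow_apply_four]; simp [initialValue]
  have hk : ∀ t, HasDerivAt (fun s => z s 2) (clip (z t 3)) t := fun t => by
    simpa [clippedField, frameField] using hasDerivAt_flow_apply (initialValue 0) t 2
  have ha : ∀ t, HasDerivAt (fun s => z s 3) (-(clip (z t 2) ^ 3 / 2)) t := fun t => by
    have := hasDerivAt_flow_apply (initialValue 0) t 3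
    simpa [clippedField, frameField, ← hz, h4, c4] using this
  have hk0 : z 0 2 = 1 := by rw [hz, flow_zero]; simp [initialValue]
  have ha0 : z 0 3 = 0 := by rw [hz, flow_zero]; simp [initialValue]
  have hc := continuous_clip
  have hc3 : Continuous fun x => clip x ^ 3 := hc.pow 3
  -- This is the energy of the truncated system, needed because the bounds that remove the
  -- truncation are not yet known. Its initial value is `1 / 4`.
  let H : ℝ → ℝ := fun t => 2 * (∫ s in 0..z t 3, clip s) + ∫ s in 0..z t 2, clip s ^ 3
  have hH : ∀ t, HasDerivAt H 0 t := fun t => by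
    have h1 := (hc.integral_hasStrictDerivAt 0 (z t 3)).hasDerivAt.comp t (ha t)
    have h2 := (hc3.integral_hasStrictDerivAt 0 (z t 2)).hasDerivAt.comp t (hk t)
    exact ((h1.const_mul 2).add h2).congr_deriv (by ring)
  have hHc : ∀ t, H t = 1 / 4 := fun t => by
    have h0 : H 0 = 1 / 4 := by
      simp only [H, hk0, ha0, intervalIntegral.integral_same]
      have : ∫ s in (0 : ℝ)..1, clip s ^ 3 = ∫ s in (0 : ℝ)..1, s ^ 3 := by
        refine intervalIntegral.integral_congr fun s hs => ?_
        rw [Set.uIcc_of_le zero_le_one] at hs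
        rw [clip_of_abs_le (by rw [abs_of_nonneg hs.1]; linarith [hs.2])]
      rw [this, integral_pow]
      norm_num
    rw [← h0]
    exact is_const_of_deriv_eq_zero (fun t => (hH t).differentiableAt) (fun t => (hH t).deriv) t 0
  have hnn : ∀ (g : ℝ → ℝ), Continuous g → (∀ x, g (-x) = -g x) → (∀ x, 0 < x → 0 < g x) →
      ∀ x, 0 ≤ ∫ s in 0..x, g s := by
    intro g hg hodd hpos x
    by_contra! h
    have := abs_le_of_integral_le hg hodd hpos (x := x) (y := 0) le_rfl (by simpa using h.le)
    have hx : x = 0 := by simpa using this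
    simp [hx] at h
  have hodd3 : ∀ x, clip (-x) ^ 3 = -clip x ^ 3 := fun x => by rw [clip_neg]; ring
  have hpos : ∀ x, 0 < x → 0 < clip x := fun x hx =>
    lt_max_of_lt_right (lt_min (by norm_num) hx)
  have hpos3 : ∀ x, 0 < x → 0 < clip x ^ 3 := fun x hx => pow_pos (hpos x hx) 3
  have hk1 : ∀ t, |z t 2| ≤ 1 := fun t => by
    refine abs_le_of_integral_le hc3 hodd3 hpos3 zero_le_one ?_
    have h1 := hHc t
    have h2 := hHc 0
    have h3 := hnn clip hc clip_neg hpos (z t 3)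
    simp only [H, hk0, ha0, intervalIntegral.integral_same] at h1 h2
    linarith
  have ha2 : ∀ t, |z t 3| ≤ 2 := fun t => by
    refine abs_le_of_integral_le hc clip_neg hpos zero_le_two ?_
    have h1 := hHc t
    have h3 := hnn _ hc3 hodd3 hpos3 (z t 2)
    have : ∫ s in (0 : ℝ)..2, clip s = ∫ s in (0 : ℝ)..2, s := by
      refine intervalIntegral.integral_congr fun s hs => ?_
      rw [Set.uIcc_of_le zero_le_two] at hs
      exact clip_of_abs_le (by rw [abs_of_nonneg hs.1]; exact hs.2)
    rw [this, integral_id]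
    simp only [H] at h1
    norm_num
    linarith
  have hk' : ∀ t, HasDerivAt (fun s => z s 2) (z t 3) t := fun t => by
    simpa [clip_of_abs_le (ha2 t)] using hk t
  have ha' : ∀ t, HasDerivAt (fun s => z s 3) (-(z t 2 ^ 3 / 2)) t := fun t => by
    simpa [clip_of_abs_le ((hk1 t).trans one_le_two)] using ha t
  have hE : ∀ t, 4 * z t 3 ^ 2 + z t 2 ^ 4 = 1 := fun t => by
    have h1 : ∀ t, HasDerivAt (fun s => 4 * z s 3 ^ 2 + z s 2 ^ 4) 0 t := fun t =>
      ((((ha' t).fun_pow 2).const_mul 4).add ((hk' t).fun_pow 4)).congr_deriv (by push_cast; ring)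
    have h2 := is_const_of_deriv_eq_zero (fun t => (h1 t).differentiableAt)
      (fun t => (h1 t).deriv) t 0
    simp only [hk0, ha0] at h2
    linarith
  have ha1 : ∀ t, |z t 3| ≤ 1 / 2 := fun t => by
    refine abs_le_of_sq_le_sq (by nlinarith [hE t, pow_nonneg (sq_nonneg (z t 2)) 2]) (by norm_num)
  refine ⟨_, _, hk', ha', hk1, ha1, hE, hk0, ha0, ?_⟩
  refine (eq_flow_of_hasDerivAt (hasDerivAt_elastica_frame hk' ha' hk1 ha1) (t₀ := 0) ?_).symm
  rw [flow_zero, hk0, ha0]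
  simp [initialValue]

/-- Half a period of the rectangular elastica. -/
theorem exists_rectangular_elastica : ∃ (k a : ℝ → ℝ) (l : ℝ), 0 < l ∧
    (∀ t, HasDerivAt k (a t) t) ∧
    (∀ t, HasDerivAt a (-(k t ^ 3 / 2)) t) ∧ (∀ t, |k t| ≤ 1) ∧ (∀ t, |a t| ≤ 1 / 2) ∧
    (∀ t, 4 * a t ^ 2 + k t ^ 4 = 1) ∧ k 0 = 1 ∧ a 0 = 0 ∧ k l = -1 ∧ a l = 0 ∧
    (∀ t ∈ Set.Ioo 0 l, a t < 0) ∧ ∫ t in 0..l, k t = 0 ∧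
    flow (initialValue 0) = fun s => ![-2 * a s, k s ^ 2, k s, a s, 0, 0] := by
  obtain ⟨k, a, hk, ha, hk1, ha1, hE, hk0, ha0, hflow⟩ := exists_elastica
  have hkc : Continuous k := continuous_iff_continuousAt.2 fun t => (hk t).continuousAt
  have hac : Continuous a := continuous_iff_continuousAt.2 fun t => (ha t).continuousAt
  have hkpos : ∀ r, 0 ≤ r → (∀ s ∈ Set.Ico 0 r, k s ≠ 0) → ∀ s ∈ Set.Ico 0 r, 0 < k s := by
    intro r _ h s hs
    by_contra! hle
    obtain ⟨x, hx, hx0⟩ := intermediate_value_Icc' hs.1 hkc.continuousOn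
      (show (0 : ℝ) ∈ Set.Icc (k s) (k 0) from ⟨hle, by rw [hk0]; exact zero_le_one⟩)
    exact h x ⟨hx.1, hx.2.trans_lt hs.2⟩ hx0
  have haneg : ∀ r, 0 ≤ r → (∀ s ∈ Set.Ico 0 r, k s ≠ 0) → StrictAntiOn a (Set.Icc 0 r) := by
    intro r hr h
    refine strictAntiOn_of_deriv_neg (convex_Icc 0 r) hac.continuousOn fun s hs => ?_
    rw [interior_Icc] at hs
    rw [(ha s).deriv]
    have := pow_pos (hkpos r hr h s ⟨hs.1.le, hs.2⟩) 3
    linarith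
  -- Without a zero, `k` stays positive and `a` decreases, so after time `1` the slope of `k` is at
  -- most `a 1 < 0`. The time `r` below is chosen so that `k` has dropped by at least `2`, although
  -- `k 1 ≤ 1`.
  have hex : ∃ s, 0 ≤ s ∧ k s = 0 := by
    by_contra! hne
    have hanti : ∀ r, 0 ≤ r → StrictAntiOn a (Set.Icc 0 r) := fun r hr =>
      haneg r hr fun s hs => hne s hs.1
    have h1 : a 1 < 0 := by
      rw [← ha0]
      exact hanti 1 zero_le_one ⟨le_rfl, zero_le_one⟩ ⟨zero_le_one, le_rfl⟩ zero_lt_one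
    obtain ⟨r, hr⟩ : ∃ r : ℝ, r = 1 + 2 / (-a 1) := ⟨_, rfl⟩
    have hr1 : 1 < r := by
      have : 0 < 2 / (-a 1) := div_pos two_pos (by linarith)
      linarith
    have h2 : k r - k 1 ≤ a 1 * (r - 1) := by
      refine (convex_Icc 1 r).image_sub_le_mul_sub_of_deriv_le hkc.continuousOn
        (fun s _ => (hk s).differentiableAt.differentiableWithinAt) (fun s hs => ?_) 1
        ⟨le_rfl, hr1.le⟩ r ⟨hr1.le, le_rfl⟩ hr1.le
      rw [interior_Icc] at hs
      rw [(hk s).deriv]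
      exact ((hanti r (by linarith)).antitoneOn ⟨zero_le_one, hr1.le⟩
        ⟨by linarith [hs.1], hs.2.le⟩ hs.1.le)
    have h3 : a 1 * (r - 1) = -2 := by
      have := h1.ne
      rw [hr]
      field_simp
      ring
    have h4 := hkpos (r + 1) (by linarith) (fun s hs => hne s hs.1) r ⟨by linarith, by linarith⟩
    have h5 := (abs_le.1 (hk1 1)).2
    linarith
  let S : Set ℝ := {s | 0 ≤ s ∧ k s = 0}
  have hSc : IsClosed S := isClosed_Ici.inter (isClosed_singleton.preimage hkc)
  have hSb : BddBelow S := ⟨0, fun s hs => hs.1⟩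
  obtain ⟨hr0, hkr⟩ : sInf S ∈ S := hSc.csInf_mem hex hSb
  set r := sInf S with hr
  have hne : ∀ s ∈ Set.Ico 0 r, k s ≠ 0 := fun s hs h0 =>
    (csInf_le hSb (show s ∈ S from ⟨hs.1, h0⟩)).not_gt hs.2
  have hrpos : 0 < r := lt_of_le_of_ne hr0 fun h => by
    rw [← h, hk0] at hkr
    exact one_ne_zero hkr
  -- Reflection in time about the first zero `r` of `k`, with `k` odd and `a` even, gives a solution
  -- with the same value at `r`. By uniqueness it is the same solution, so `2 r` is a half period
  -- and `k` has integral zero over it.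
  have hsymm : (fun s => (![-2 * a (2 * r - s), (-k (2 * r - s)) ^ 2, -k (2 * r - s), a (2 * r - s),
      0, 0] : Fin 6 → ℝ)) = flow (initialValue 0) := by
    refine eq_flow_of_hasDerivAt (t₀ := r) (hasDerivAt_elastica_frame (k := fun s => -k (2 * r - s))
      (a := fun s => a (2 * r - s)) (fun t => ?_) (fun t => ?_) (fun t => ?_) fun t => ?_) ?_
    · simpa using ((hk (2 * r - t)).comp_const_sub (2 * r) t).fun_neg
    · exact ((ha (2 * r - t)).comp_const_sub (2 * r) t).congr_deriv (by ring)
    · rw [abs_neg]; exact hk1 _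
    · exact ha1 _
    · have h2r : 2 * r - r = r := by ring
      simp only [hflow, h2r, hkr, neg_zero]
  have hks : ∀ s, -k (2 * r - s) = k s := fun s => by
    have := congrFun (congrFun (hsymm.trans hflow) s) 2
    simpa using this
  have has : ∀ s, a (2 * r - s) = a s := fun s => by
    have := congrFun (congrFun (hsymm.trans hflow) s) 3
    simpa using this
  have haneg1 : ∀ s ∈ Set.Ioc 0 r, a s < 0 := fun s hs => by
    rw [← ha0]
    exact haneg r hr0 hne ⟨le_rfl, hr0⟩ ⟨hs.1.le, hs.2⟩ hs.1
  refine ⟨k, a, 2 * r, by linarith, hk, ha, hk1, ha1, hE, hk0, ha0, ?_, ?_, fun s hs => ?_, ?_,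
    hflow⟩
  · rw [← hks, sub_self, hk0]
  · rw [← has, sub_self, ha0]
  · rcases le_total s r with h | h
    · exact haneg1 s ⟨hs.1, h⟩
    · rw [← has]
      exact haneg1 _ ⟨by linarith [hs.2], by linarith⟩
  · have h1 := intervalIntegral.integral_comp_sub_left (a := 0) (b := 2 * r) k (2 * r)
    rw [sub_self, sub_zero] at h1
    have h2 : ∫ s in 0..2 * r, k (2 * r - s) = -∫ s in 0..2 * r, k s := by
      rw [← intervalIntegral.integral_neg]
      refine intervalIntegral.integral_congr fun s _ => ?_
      simp only [← hks s, neg_neg]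
    linarith

/-- The energy identity makes `(k², -2 a)` a unit vector. Its inner product with `(cos θ, sin θ)` is
constant and equals `1` at time `0`, so the two vectors agree. Hence the limiting value of `X` is `∫
k² > 0`. -/
theorem cos_integral_elastica {k a : ℝ → ℝ} (hk : ∀ t, HasDerivAt k (a t) t)
    (ha : ∀ t, HasDerivAt a (-(k t ^ 3 / 2)) t) (hE : ∀ t, 4 * a t ^ 2 + k t ^ 4 = 1)
    (hk0 : k 0 = 1) (ha0 : a 0 = 0) (t : ℝ) : Real.cos (∫ s in 0..t, k s) = k t ^ 2 := by
  have hkc : Continuous k := continuous_iff_continuousAt.2 fun t => (hk t).continuousAt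
  set θ : ℝ → ℝ := fun t => ∫ s in 0..t, k s with hθ
  have hθ' : ∀ t, HasDerivAt θ (k t) t := fun t => (hkc.integral_hasStrictDerivAt 0 t).hasDerivAt
  have h1 : ∀ t, HasDerivAt (fun s => k s ^ 2 * Real.cos (θ s) - 2 * a s * Real.sin (θ s)) 0 t :=
    fun t => ((((hk t).fun_pow 2).mul (hθ' t).cos).sub
      (((ha t).const_mul 2).mul (hθ' t).sin)).congr_deriv (by push_cast; ring)
  have h2 := is_const_of_deriv_eq_zero (fun t => (h1 t).differentiableAt)
      (fun t => (h1 t).deriv) t 0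
  have h3 : θ 0 = 0 := by simp [hθ]
  simp only [h3, hk0, ha0, Real.cos_zero] at h2
  have h4 : (k t ^ 2 - Real.cos (θ t)) ^ 2 + (2 * a t + Real.sin (θ t)) ^ 2 = 0 := by
    nlinarith [hE t, Real.sin_sq_add_cos_sq (θ t)]
  have h5 : (k t ^ 2 - Real.cos (θ t)) ^ 2 = 0 := by
    nlinarith [sq_nonneg (k t ^ 2 - Real.cos (θ t)), sq_nonneg (2 * a t + Real.sin (θ t))]
  have := pow_eq_zero_iff two_ne_zero |>.1 h5
  linarith

/-! ### A fixed point for small parameters -/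

-- For small `t` the map `p ↦ t • h p` sends a small ball into itself and contracts it. This needs
-- only a Lipschitz bound for `h`, so no differentiable dependence of the flow on parameters is
-- required.
open Topology in
theorem eventually_exists_eq_smul_of_lipschitzOnWith {F : Type*} [NormedAddCommGroup F]
    [NormedSpace ℝ F] [CompleteSpace F] {h : F → F} {K : NNReal} {s U : Set F} (hs : s ∈ 𝓝 0)
    (hU : U ∈ 𝓝 0) (hh : LipschitzOnWith K h s) : ∀ᶠ t : ℝ in 𝓝 0, ∃ p ∈ U, p = t • h p := by
  obtain ⟨r, hr, hrs⟩ := Metric.nhds_basis_closedBall.mem_iff.1 (Filter.inter_mem hs hU)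
  have h1 : ∀ᶠ t : ℝ in 𝓝 0, |t| * (‖h 0‖ + K * r) < r := by
    have : Filter.Tendsto (fun t : ℝ => |t| * (‖h 0‖ + K * r)) (𝓝 0) (𝓝 (|0| * (‖h 0‖ + K * r))) :=
      (continuous_abs.mul continuous_const).tendsto 0
    rw [abs_zero, zero_mul] at this
    exact this.eventually (gt_mem_nhds hr)
  have h2 : ∀ᶠ t : ℝ in 𝓝 0, |t| * K < 1 := by
    have : Filter.Tendsto (fun t : ℝ => |t| * K) (𝓝 0) (𝓝 (|0| * K)) :=
      (continuous_abs.mul continuous_const).tendsto 0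
    rw [abs_zero, zero_mul] at this
    exact this.eventually (gt_mem_nhds one_pos)
  filter_upwards [h1, h2] with t ht1 ht2
  let B : Set F := Metric.closedBall 0 r
  have hB0 : (0 : F) ∈ B := Metric.mem_closedBall_self hr.le
  have hlip : LipschitzOnWith (‖t‖₊ * K) (fun p => t • h p) B :=
    LipschitzOnWith.of_dist_le_mul fun x hx y hy => by
      rw [dist_smul₀, NNReal.coe_mul, coe_nnnorm, mul_assoc]
      exact mul_le_mul_of_nonneg_left (hh.dist_le_mul x (hrs hx).1 y (hrs hy).1) (norm_nonneg _)
  have hmaps : Set.MapsTo (fun p => t • h p) B B := fun p hp => by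
    have hp' : ‖p‖ ≤ r := by simpa [B] using hp
    have h3 := hh.dist_le_mul p (hrs hp).1 0 (hrs hB0).1
    rw [dist_zero_right, dist_eq_norm] at h3
    have h4 : ‖h p‖ ≤ ‖h 0‖ + K * r := by
      have := norm_le_norm_add_norm_sub' (h p) (h 0)
      have := mul_le_mul_of_nonneg_left hp' K.coe_nonneg
      linarith
    simp only [B, mem_closedBall_zero_iff, norm_smul, Real.norm_eq_abs]
    exact (mul_le_mul_of_nonneg_left h4 (abs_nonneg t)).trans ht1.le
  have hcontr : ContractingWith (‖t‖₊ * K) (hmaps.restrict _ B B) := by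
    refine ⟨?_, hlip.mapsToRestrict hmaps⟩
    rw [← NNReal.coe_lt_coe]
    simpa using ht2
  obtain ⟨p, hp, hfix, -⟩ := hcontr.exists_fixedPoint' Metric.isClosed_closedBall.isComplete hmaps
    hB0 (edist_ne_top _ _)
  exact ⟨p, (hrs hp).2, hfix.symm⟩

/-! ### Uniform estimates near the elastica -/

/-- The solution of the clipped system with parameters `p = (ε, δ)`. -/
noncomputable def trajectory (p : ℝ × ℝ) : ℝ → Fin 6 → ℝ := flow (initialValue p)

/-- Estimates for the trajectories with parameters in a ball of radius `r`, close to the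
rectangular elastica with half period `l`. -/
structure UniformBounds (l C r : ℝ) : Prop where
  r_pos : 0 < r
  r_le : r ≤ 1 / 100
  C_nonneg : 0 ≤ C
  four_le : 4 ≤ l
  dist_le : ∀ p ∈ Metric.closedBall (0 : ℝ × ℝ) r, ∀ q ∈ Metric.closedBall (0 : ℝ × ℝ) r,
    ∀ s ∈ Set.Icc 0 (l + 1), ∀ i, |trajectory p s i - trajectory q s i| ≤ C * dist p q
  abs_le_two : ∀ p ∈ Metric.closedBall (0 : ℝ × ℝ) r, ∀ s ∈ Set.Icc 0 (l + 1), ∀ i,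
    |trajectory p s i| ≤ 2
  near_start : ∀ p ∈ Metric.closedBall (0 : ℝ × ℝ) r, ∀ s ∈ Set.Icc 0 (1 / 10),
    9 / 10 ≤ trajectory p s 2 ∧ 4 / 5 ≤ trajectory p s 1
  near_end : ∀ p ∈ Metric.closedBall (0 : ℝ × ℝ) r, ∀ s ∈ Set.Icc (l - 1 / 10) (l + 1 / 10),
    trajectory p s 2 ≤ -(9 / 10) ∧ 4 / 5 ≤ trajectory p s 1
  middle : ∀ p ∈ Metric.closedBall (0 : ℝ × ℝ) r, ∀ s ∈ Set.Icc (1 / 10) (l - 1 / 10),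
    0 < trajectory p s 0
  before : ∀ p ∈ Metric.closedBall (0 : ℝ × ℝ) r, trajectory p (l - 1 / 10) 3 < 0
  after : ∀ p ∈ Metric.closedBall (0 : ℝ × ℝ) r, 0 < trajectory p (l + 1 / 10) 3
  base_end : trajectory 0 l 3 = 0
  base_angle : ∫ s in 0..l, trajectory 0 s 2 = 0
  base_cos : 0 < ∫ s in 0..l, Real.cos (∫ x in 0..s, trajectory 0 x 2)
  base_curvature : 0 < ∫ s in 0..l, trajectory 0 s 2 ^ 2 / 2
  base_normal : 0 < ∫ s in 0..l, trajectory 0 s 1 ^ 2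

theorem dist_initialValue_le (p q : ℝ × ℝ) : dist (initialValue p) (initialValue q) ≤ dist p q := by
  refine (dist_pi_le_iff dist_nonneg).2 fun i => ?_
  fin_cases i <;> simp [initialValue, Prod.dist_eq]

theorem abs_sub_le_half_of_elastica {k a : ℝ → ℝ} (hk : ∀ t, HasDerivAt k (a t) t)
    (ha1 : ∀ t, |a t| ≤ 1 / 2) (s t : ℝ) : |k s - k t| ≤ 1 / 2 * |s - t| := by
  simpa using (convex_univ (𝕜 := ℝ) (E := ℝ)).norm_image_sub_le_of_norm_hasDerivWithin_le
    (f := k) (fun x _ => (hk x).hasDerivWithinAt) (fun x _ => ha1 x) (Set.mem_univ t)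
    (Set.mem_univ s)

theorem exists_uniformBounds : ∃ l C r, UniformBounds l C r := by
  obtain ⟨k, a, l, hl, hk, ha, hk1, ha1, hE, hk0, ha0, hkl, hal, haneg, hint, hflow⟩ :=
    exists_rectangular_elastica
  have hkc : Continuous k := continuous_iff_continuousAt.2 fun t => (hk t).continuousAt
  have hac : Continuous a := continuous_iff_continuousAt.2 fun t => (ha t).continuousAt
  have hl4 : 4 ≤ l := by
    have := abs_sub_le_half_of_elastica hk ha1 l 0
    rw [hkl, hk0, sub_zero, abs_of_pos hl] at this
    norm_num at this
    linarith
  obtain ⟨K, -, hK, -⟩ := exists_lipschitzWith_clippedField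
  -- This is the Gronwall factor on `[0, l + 1]`.
  set C : ℝ := Real.exp (K * (l + 1)) with hC
  have hCpos : 0 < C := Real.exp_pos _
  have hdist : ∀ p q : ℝ × ℝ, ∀ s ∈ Set.Icc 0 (l + 1), ∀ i,
      |trajectory p s i - trajectory q s i| ≤ C * dist p q := by
    intro p q s hs i
    have h1 := dist_le_mul_exp_of_hasDerivAt hK (hasDerivAt_flow (initialValue p))
      (hasDerivAt_flow (initialValue q)) hs.1
    rw [flow_zero, flow_zero] at h1
    have h2 : Real.exp (K * s) ≤ C := Real.exp_le_exp.2 (mul_le_mul_of_nonneg_left hs.2 K.2)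
    have h3 := dist_le_pi_dist (trajectory p s) (trajectory q s) i
    rw [Real.dist_eq] at h3
    refine h3.trans (h1.trans ?_)
    rw [mul_comm]
    exact mul_le_mul h2 (dist_initialValue_le p q) dist_nonneg hCpos.le
  obtain ⟨μ, hμ, hμa⟩ : ∃ μ > 0, ∀ s ∈ Set.Icc (1 / 10) (l - 1 / 10), a s ≤ -μ := by
    obtain ⟨x, hx, hmax⟩ := (isCompact_Icc (a := (1 / 10 : ℝ)) (b := l - 1 / 10)).exists_isMaxOn
      ⟨1 / 10, le_rfl, by linarith⟩ hac.continuousOn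
    refine ⟨-a x, neg_pos.2 (haneg x ⟨by linarith [hx.1], by linarith [hx.2]⟩), fun s hs => ?_⟩
    rw [neg_neg]
    exact hmax hs
  -- The tolerance `ρ ≤ μ` keeps `u` positive in the middle, where the elastica has `u = -2 a ≥ 2
  -- μ`. The bound `1 / 100` is for the explicit estimates near the ends.
  set ρ : ℝ := min (1 / 100) μ with hρ
  have hρpos : 0 < ρ := lt_min (by norm_num) hμ
  have hρ1 : ρ ≤ 1 / 100 := min_le_left _ _
  have hρ2 : ρ ≤ μ := min_le_right _ _
  set r : ℝ := min (1 / 100) (ρ / C) with hr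
  have hbase : ∀ s, trajectory 0 s = ![-2 * a s, k s ^ 2, k s, a s, 0, 0] := fun s => by
    rw [trajectory, hflow]
  have hb0 : ∀ s, trajectory 0 s 0 = -2 * a s := fun s => by rw [hbase]; simp
  have hb1 : ∀ s, trajectory 0 s 1 = k s ^ 2 := fun s => by rw [hbase]; simp
  have hb2 : ∀ s, trajectory 0 s 2 = k s := fun s => by rw [hbase]; simp
  have hb3 : ∀ s, trajectory 0 s 3 = a s := fun s => by rw [hbase]; simp
  have hclose : ∀ p ∈ Metric.closedBall (0 : ℝ × ℝ) r, ∀ s ∈ Set.Icc 0 (l + 1), ∀ i,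
      |trajectory p s i - trajectory 0 s i| ≤ ρ := by
    intro p hp s hs i
    refine (hdist p 0 s hs i).trans ?_
    have h1 : dist p 0 ≤ ρ / C := (Metric.mem_closedBall.1 hp).trans (min_le_right _ _)
    calc C * dist p 0 ≤ C * (ρ / C) := mul_le_mul_of_nonneg_left h1 hCpos.le
      _ = ρ := by field_simp
  have hks : ∀ s t, |k s - k t| ≤ 1 / 2 * |s - t| := abs_sub_le_half_of_elastica hk ha1
  have hkend : ∀ s ∈ Set.Icc (l - 1 / 10) (l + 1 / 10), k s ≤ -(95 / 100) := fun s hs => by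
    have h1 := (abs_le.1 (hks s l)).2
    have h2 : |s - l| ≤ 1 / 10 := abs_le.2 ⟨by linarith [hs.1], by linarith [hs.2]⟩
    linarith
  have hkstart : ∀ s ∈ Set.Icc (0 : ℝ) (1 / 10), 95 / 100 ≤ k s := fun s hs => by
    have h1 := (abs_le.1 (hks s 0)).1
    have h2 : |s - 0| ≤ 1 / 10 := abs_le.2 ⟨by linarith [hs.1], by linarith [hs.2]⟩
    linarith
  -- Here `a' = -k³ / 2 ≥ 0.95³ / 2 > 2 / 5`. So `a` differs from `a l = 0` by at least `1 / 25` at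
  -- `l ± 1 / 10`, which exceeds `ρ`.
  have haend : ∀ x ∈ Set.Icc (l - 1 / 10) (l + 1 / 10), ∀ y ∈ Set.Icc (l - 1 / 10) (l + 1 / 10),
      x ≤ y → 2 / 5 * (y - x) ≤ a y - a x := by
    refine (convex_Icc _ _).mul_sub_le_image_sub_of_le_deriv hac.continuousOn
      (fun s _ => (ha s).differentiableAt.differentiableWithinAt) fun s hs => ?_
    have h1 := hkend s (interior_subset hs)
    rw [(ha s).deriv]
    have h2 : (95 / 100 : ℝ) ^ 3 ≤ (-k s) ^ 3 :=
      pow_le_pow_left₀ (by norm_num) (by linarith) 3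
    have h3 : (-k s) ^ 3 = -(k s ^ 3) := by ring
    rw [h3] at h2
    norm_num at h2
    linarith
  have hall : ∀ s i, |trajectory 0 s i| ≤ 1 := by
    intro s i
    have h1 := hk1 s
    have h2 := ha1 s
    rw [hbase]
    fin_cases i <;> simp
    · linarith
    · exact h1
    · exact h1
    · linarith
  refine ⟨l, C, r, lt_min (by norm_num) (by positivity), min_le_left _ _, hCpos.le, hl4,
    fun p _ q _ => hdist p q, ?_, ?_, ?_, ?_, ?_, ?_, ?_, ?_, ?_, ?_, ?_⟩
  · intro p hp s hs i
    have h1 := hclose p hp s hs i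
    have h2 := hall s i
    have h3 := abs_sub_abs_le_abs_sub (trajectory p s i) (trajectory 0 s i)
    linarith
  · intro p hp s hs
    have hs' : s ∈ Set.Icc 0 (l + 1) := ⟨hs.1, by linarith [hs.2]⟩
    have h1 := (abs_le.1 (hclose p hp s hs' 1)).1
    have h2 := (abs_le.1 (hclose p hp s hs' 2)).1
    have h3 := hkstart s hs
    rw [hb1] at h1
    rw [hb2] at h2
    constructor <;> nlinarith
  · intro p hp s hs
    have hs' : s ∈ Set.Icc 0 (l + 1) := ⟨by linarith [hs.1], by linarith [hs.2]⟩
    have h1 := (abs_le.1 (hclose p hp s hs' 1)).1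
    have h2 := (abs_le.1 (hclose p hp s hs' 2)).2
    have h3 := hkend s hs
    rw [hb1] at h1
    rw [hb2] at h2
    constructor <;> nlinarith
  · intro p hp s hs
    have h1 := (abs_le.1 (hclose p hp s ⟨by linarith [hs.1], by linarith [hs.2]⟩ 0)).1
    have h2 := hμa s hs
    rw [hb0] at h1
    linarith
  · intro p hp
    have h1 := (abs_le.1 (hclose p hp (l - 1 / 10) ⟨by linarith, by linarith⟩ 3)).2
    have h2 := haend (l - 1 / 10) ⟨by linarith, by linarith⟩ l ⟨by linarith, by linarith⟩
      (by linarith)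
    rw [hb3] at h1
    linarith
  · intro p hp
    have h1 := (abs_le.1 (hclose p hp (l + 1 / 10) ⟨by linarith, by linarith⟩ 3)).1
    have h2 := haend l ⟨by linarith, by linarith⟩ (l + 1 / 10) ⟨by linarith, by linarith⟩
      (by linarith)
    rw [hb3] at h1
    linarith
  · rw [hb3, hal]
  · simpa only [hb2] using hint
  · simp only [hb2, cos_integral_elastica hk ha hE hk0 ha0]
    exact intervalIntegral.integral_pos hl (hkc.pow 2).continuousOn (fun s _ => sq_nonneg _)
      ⟨0, ⟨le_rfl, hl.le⟩, by rw [hk0]; norm_num⟩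
  · simp only [hb2]
    exact intervalIntegral.integral_pos hl ((hkc.pow 2).div_const 2).continuousOn
      (fun s _ => by positivity) ⟨0, ⟨le_rfl, hl.le⟩, by rw [hk0]; norm_num⟩
  · simp only [hb1]
    exact intervalIntegral.integral_pos hl ((hkc.pow 2).pow 2).continuousOn
      (fun s _ => sq_nonneg _) ⟨0, ⟨le_rfl, hl.le⟩, by rw [hk0]; norm_num⟩

/-! ### Lipschitz dependence on the parameters -/

theorem abs_mul_sub_mul_le {x y x' y' d : ℝ} (hx : |x| ≤ 2) (hy' : |y'| ≤ 2) (hxx : |x - x'| ≤ d)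
    (hyy : |y - y'| ≤ d) : |x * y - x' * y'| ≤ 4 * d := by
  have h1 : x * y - x' * y' = x * (y - y') + (x - x') * y' := by ring
  have hd : 0 ≤ d := (abs_nonneg _).trans hxx
  have h2 : |x * (y - y')| ≤ 2 * d := by
    rw [abs_mul]; exact mul_le_mul hx hyy (abs_nonneg _) (by norm_num)
  have h3 : |(x - x') * y'| ≤ d * 2 := by
    rw [abs_mul]; exact mul_le_mul hxx hy' (abs_nonneg _) hd
  rw [h1]
  linarith [abs_add_le (x * (y - y')) ((x - x') * y')]

/-- Changing the integrand costs at most `C T` times the distance, and moving the endpoint at most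
`M K` times the distance. -/
theorem exists_lipschitzOnWith_integral {S : Set (ℝ × ℝ)} {g : ℝ × ℝ → ℝ → ℝ} {l : ℝ × ℝ → ℝ}
    {T M C : ℝ} {K : NNReal} (hM : 0 ≤ M) (hC : 0 ≤ C) (hT : 0 ≤ T) (hg : ∀ p ∈ S, Continuous (g p))
    (hbd : ∀ p ∈ S, ∀ s ∈ Set.Icc 0 T, |g p s| ≤ M)
    (hd : ∀ p ∈ S, ∀ q ∈ S, ∀ s ∈ Set.Icc 0 T, |g p s - g q s| ≤ C * dist p q)
    (hl : ∀ p ∈ S, l p ∈ Set.Icc 0 T) (hlK : LipschitzOnWith K l S) :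
    ∃ K' : NNReal, LipschitzOnWith K' (fun p => ∫ s in 0..l p, g p s) S := by
  refine ⟨⟨C * T + M * K, by positivity⟩, LipschitzOnWith.of_dist_le_mul fun p hp q hq => ?_⟩
  have hip := fun a b => (hg p hp).intervalIntegrable (μ := MeasureTheory.volume) a b
  have hiq := fun a b => (hg q hq).intervalIntegrable (μ := MeasureTheory.volume) a b
  have h1 : (∫ s in 0..l p, g p s) - ∫ s in 0..l q, g q s =
      (∫ s in 0..l p, (g p s - g q s)) + ∫ s in l q..l p, g q s := by
    rw [intervalIntegral.integral_sub (hip _ _) (hiq _ _),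
      ← intervalIntegral.integral_add_adjacent_intervals (hiq 0 (l q)) (hiq (l q) (l p))]
    ring
  have h2 : |∫ s in 0..l p, (g p s - g q s)| ≤ C * dist p q * T := by
    have := intervalIntegral.norm_integral_le_of_norm_le_const (a := 0) (b := l p)
      (f := fun s => g p s - g q s) (C := C * dist p q) fun s hs => by
        rw [Set.uIoc_of_le (hl p hp).1] at hs
        exact hd p hp q hq s ⟨hs.1.le, hs.2.trans (hl p hp).2⟩
    rw [sub_zero, abs_of_nonneg (hl p hp).1] at this
    exact this.trans (mul_le_mul_of_nonneg_left (hl p hp).2 (mul_nonneg hC dist_nonneg))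
  have h3 : |∫ s in l q..l p, g q s| ≤ M * (K * dist p q) := by
    have := intervalIntegral.norm_integral_le_of_norm_le_const (a := l q) (b := l p)
      (f := g q) (C := M) fun s hs => by
        have hs' := Set.uIcc_subset_Icc (hl q hq) (hl p hp) (Set.uIoc_subset_uIcc hs)
        exact hbd q hq s hs'
    refine this.trans (mul_le_mul_of_nonneg_left ?_ hM)
    have h4 := hlK.dist_le_mul p hp q hq
    rwa [Real.dist_eq] at h4
  rw [Real.dist_eq, h1]
  have h5 := abs_add_le (∫ s in 0..l p, (g p s - g q s)) (∫ s in l q..l p, g q s)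
  change _ ≤ (C * T + M * K) * dist p q
  linarith

theorem trajectory_apply_four (p : ℝ × ℝ) (s : ℝ) : trajectory p s 4 = p.1 := by
  rw [trajectory, flow_apply_four]; simp [initialValue]

theorem trajectory_apply_five (p : ℝ × ℝ) (s : ℝ) : trajectory p s 5 = p.2 := by
  rw [trajectory, flow_apply_five]; simp [initialValue]

theorem trajectory_zero (p : ℝ × ℝ) : trajectory p 0 = initialValue p := flow_zero _

theorem continuous_trajectory (p : ℝ × ℝ) (i : Fin 6) : Continuous fun s => trajectory p s i :=
  (continuous_apply i).comp (continuous_flow _)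

theorem hasDerivAt_trajectory {p : ℝ × ℝ} {s : ℝ} (h : ∀ i, |trajectory p s i| ≤ 2) (i : Fin 6) :
    HasDerivAt (fun s => trajectory p s i) (frameField (trajectory p s) i) s := by
  have h1 : (fun i => clip (trajectory p s i)) = trajectory p s :=
    funext fun i => clip_of_abs_le (h i)
  have h2 := hasDerivAt_flow_apply (initialValue p) s i
  change HasDerivAt _ (frameField (fun i => clip (trajectory p s i)) i) s at h2
  rwa [h1] at h2

theorem hasDerivAt_trajectory_zero {p : ℝ × ℝ} {s : ℝ} (h : ∀ i, |trajectory p s i| ≤ 2) :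
    HasDerivAt (fun s => trajectory p s 0) (p.2 + trajectory p s 2 * trajectory p s 1) s := by
  simpa [frameField, trajectory_apply_five] using hasDerivAt_trajectory h 0

theorem hasDerivAt_trajectory_one {p : ℝ × ℝ} {s : ℝ} (h : ∀ i, |trajectory p s i| ≤ 2) :
    HasDerivAt (fun s => trajectory p s 1) (-(trajectory p s 2 * trajectory p s 0)) s := by
  simpa [frameField] using hasDerivAt_trajectory h 1

theorem hasDerivAt_trajectory_two {p : ℝ × ℝ} {s : ℝ} (h : ∀ i, |trajectory p s i| ≤ 2) :
    HasDerivAt (fun s => trajectory p s 2) (trajectory p s 3) s := by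
  simpa [frameField] using hasDerivAt_trajectory h 2

theorem hasDerivAt_trajectory_three {p : ℝ × ℝ} {s : ℝ} (h : ∀ i, |trajectory p s i| ≤ 2) :
    HasDerivAt (fun s => trajectory p s 3)
      (-(trajectory p s 2 ^ 3 / 2) - p.1 * trajectory p s 1) s := by
  simpa [frameField, trajectory_apply_four] using hasDerivAt_trajectory h 3

/-! ### The end time of the half period -/

namespace UniformBounds

variable {l C r : ℝ}

theorem abs_fst_le (hb : UniformBounds l C r) {p : ℝ × ℝ} (hp : p ∈ Metric.closedBall 0 r) :
    |p.1| ≤ 1 / 100 := by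
  rw [mem_closedBall_zero_iff] at hp
  exact (norm_fst_le p).trans (hp.trans hb.r_le)

theorem abs_snd_le (hb : UniformBounds l C r) {p : ℝ × ℝ} (hp : p ∈ Metric.closedBall 0 r) :
    |p.2| ≤ 1 / 100 := by
  rw [mem_closedBall_zero_iff] at hp
  exact (norm_snd_le p).trans (hp.trans hb.r_le)

/-- Near the end `k ≤ -9 / 10`, so `-k³ / 2 ≥ 0.9³ / 2`, while the perturbation `ε v` is at most `1
/ 50`. -/
theorem slope (hb : UniformBounds l C r) {p : ℝ × ℝ} (hp : p ∈ Metric.closedBall 0 r) :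
    ∀ x ∈ Set.Icc (l - 1 / 10) (l + 1 / 10), ∀ y ∈ Set.Icc (l - 1 / 10) (l + 1 / 10),
      x ≤ y → 1 / 4 * (y - x) ≤ trajectory p y 3 - trajectory p x 3 := by
  have hl := hb.four_le
  have hder : ∀ s ∈ Set.Icc (l - 1 / 10) (l + 1 / 10), HasDerivAt (fun s => trajectory p s 3)
      (-(trajectory p s 2 ^ 3 / 2) - p.1 * trajectory p s 1) s := fun s hs =>
    hasDerivAt_trajectory_three
      (hb.abs_le_two p hp s ⟨by linarith [hs.1], by linarith [hs.2]⟩)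
  refine (convex_Icc _ _).mul_sub_le_image_sub_of_le_deriv
    (continuous_trajectory p 3).continuousOn
    (fun s hs => (hder s (interior_subset hs)).differentiableAt.differentiableWithinAt)
    fun s hs => ?_
  replace hs := interior_subset hs
  rw [(hder s hs).deriv]
  have h1 := (hb.near_end p hp s hs).1
  have h2 := hb.abs_le_two p hp s ⟨by linarith [hs.1], by linarith [hs.2]⟩ 1
  have h3 : |p.1 * trajectory p s 1| ≤ 1 / 100 * 2 := by
    rw [abs_mul]
    exact mul_le_mul (hb.abs_fst_le hp) h2 (abs_nonneg _) (by norm_num)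
  have h4 : (9 / 10 : ℝ) ^ 3 ≤ (-trajectory p s 2) ^ 3 :=
    pow_le_pow_left₀ (by norm_num) (by linarith) 3
  have h5 : (-trajectory p s 2) ^ 3 = -(trajectory p s 2 ^ 3) := by ring
  rw [h5] at h4
  norm_num at h4
  linarith [(abs_le.1 h3).2]

theorem abs_sub_le (hb : UniformBounds l C r) {p : ℝ × ℝ} (hp : p ∈ Metric.closedBall 0 r)
    {x y : ℝ} (hx : x ∈ Set.Icc (l - 1 / 10) (l + 1 / 10))
    (hy : y ∈ Set.Icc (l - 1 / 10) (l + 1 / 10)) :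
    |y - x| ≤ 4 * |trajectory p y 3 - trajectory p x 3| := by
  rcases le_total x y with h | h
  · have := hb.slope hp x hx y hy h
    rw [abs_of_nonneg (by linarith)]
    linarith [le_abs_self (trajectory p y 3 - trajectory p x 3)]
  · have := hb.slope hp y hy x hx h
    rw [abs_of_nonpos (by linarith)]
    linarith [neg_abs_le (trajectory p y 3 - trajectory p x 3)]

/-- The end time is the zero of `a` near `l`. The slope bound converts the Lipschitz dependence of
`a` on the parameters into one for its zero, which replaces the implicit function theorem. -/
theorem exists_endTime (hb : UniformBounds l C r) : ∃ (e : ℝ × ℝ → ℝ) (K : NNReal),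
    (∀ p ∈ Metric.closedBall 0 r, e p ∈ Set.Icc (l - 1 / 10) (l + 1 / 10) ∧
      trajectory p (e p) 3 = 0) ∧ LipschitzOnWith K e (Metric.closedBall 0 r) ∧ e 0 = l := by
  have hl := hb.four_le
  have hex : ∀ p : ℝ × ℝ, ∃ x, p ∈ Metric.closedBall 0 r →
      x ∈ Set.Icc (l - 1 / 10) (l + 1 / 10) ∧ trajectory p x 3 = 0 := by
    intro p
    by_cases hp : p ∈ Metric.closedBall 0 r
    · obtain ⟨x, hx, hx0⟩ := intermediate_value_Icc (show l - 1 / 10 ≤ l + 1 / 10 by linarith)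
        (continuous_trajectory p 3).continuousOn
        (show (0 : ℝ) ∈ Set.Icc _ _ from ⟨(hb.before p hp).le, (hb.after p hp).le⟩)
      exact ⟨x, fun _ => ⟨hx, hx0⟩⟩
    · exact ⟨0, fun h => absurd h hp⟩
  choose e he using hex
  have hC := hb.C_nonneg
  refine ⟨e, ⟨4 * C, by positivity⟩, he, LipschitzOnWith.of_dist_le_mul fun p hp q hq => ?_, ?_⟩
  · have h1 := hb.abs_sub_le hp (he q hq).1 (he p hp).1
    have h2 := hb.dist_le p hp q hq (e q)
      ⟨by linarith [(he q hq).1.1], by linarith [(he q hq).1.2]⟩ 3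
    rw [(he p hp).2] at h1
    rw [(he q hq).2] at h2
    rw [zero_sub, abs_neg] at h1
    rw [sub_zero] at h2
    rw [Real.dist_eq]
    change _ ≤ 4 * C * dist p q
    linarith
  · have h0 : (0 : ℝ × ℝ) ∈ Metric.closedBall 0 r := Metric.mem_closedBall_self hb.r_pos.le
    have h1 := hb.abs_sub_le h0 (x := l) ⟨by linarith, by linarith⟩ (he 0 h0).1
    rw [(he 0 h0).2, hb.base_end, sub_self, abs_zero, mul_zero, abs_nonpos_iff] at h1
    linarith

/-- Since `u' = δ + k v`, the function `u` rises from `0` at the start and falls to `0` at the end.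
In between it is positive by closeness to the elastica. -/
theorem pos_of_mem_Ioo (hb : UniformBounds l C r) {p : ℝ × ℝ} (hp : p ∈ Metric.closedBall 0 r)
    {x : ℝ} (hx : x ∈ Set.Icc (l - 1 / 10) (l + 1 / 10)) (hx0 : trajectory p x 0 = 0) :
    ∀ s ∈ Set.Ioo 0 x, 0 < trajectory p s 0 := by
  have hl := hb.four_le
  have hδ := abs_le.1 (hb.abs_snd_le hp)
  have hder : ∀ s ∈ Set.Icc 0 (l + 1), HasDerivAt (fun s => trajectory p s 0)
      (p.2 + trajectory p s 2 * trajectory p s 1) s := fun s hs =>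
    hasDerivAt_trajectory_zero (hb.abs_le_two p hp s hs)
  intro s hs
  rcases le_total s (1 / 10) with h | h
  · have hmono : StrictMonoOn (fun s => trajectory p s 0) (Set.Icc 0 (1 / 10)) := by
      refine strictMonoOn_of_deriv_pos (convex_Icc _ _) (continuous_trajectory p 0).continuousOn
        fun y hy => ?_
      replace hy := interior_subset hy
      rw [(hder y ⟨hy.1, by linarith [hy.2]⟩).deriv]
      obtain ⟨h1, h2⟩ := hb.near_start p hp y hy
      nlinarith
    have h3 := hmono (show (0 : ℝ) ∈ Set.Icc 0 (1 / 10) by norm_num) ⟨hs.1.le, h⟩ hs.1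
    simpa [trajectory_zero, initialValue] using h3
  rcases le_total s (l - 1 / 10) with h' | h'
  · exact hb.middle p hp s ⟨h, h'⟩
  · have hanti : StrictAntiOn (fun s => trajectory p s 0)
        (Set.Icc (l - 1 / 10) (l + 1 / 10)) := by
      refine strictAntiOn_of_deriv_neg (convex_Icc _ _) (continuous_trajectory p 0).continuousOn
        fun y hy => ?_
      replace hy := interior_subset hy
      rw [(hder y ⟨by linarith [hy.1], by linarith [hy.2]⟩).deriv]
      obtain ⟨h1, h2⟩ := hb.near_end p hp y hy
      nlinarith
    have h3 := hanti ⟨h', by linarith [hs.2, hx.2]⟩ hx hs.2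
    simpa [hx0] using h3

end UniformBounds

namespace UniformBounds

variable {l C r : ℝ}

theorem exists_lipschitzOnWith_of_endTime (hb : UniformBounds l C r) {e : ℝ × ℝ → ℝ} {K : NNReal}
    (he : ∀ p ∈ Metric.closedBall 0 r, e p ∈ Set.Icc (l - 1 / 10) (l + 1 / 10))
    (hK : LipschitzOnWith K e (Metric.closedBall 0 r)) :
    (∃ K' : NNReal, LipschitzOnWith K' (fun p => ∫ s in 0..e p, trajectory p s 2 ^ 2 / 2)
      (Metric.closedBall 0 r)) ∧
    (∃ K' : NNReal, LipschitzOnWith K' (fun p => ∫ s in 0..e p, trajectory p s 1 ^ 2)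
      (Metric.closedBall 0 r)) ∧
    (∃ K' : NNReal, LipschitzOnWith K' (fun p => ∫ s in 0..e p, trajectory p s 2)
      (Metric.closedBall 0 r)) ∧
    (∃ K' : NNReal, LipschitzOnWith K'
      (fun p => ∫ s in 0..e p, Real.cos (∫ x in 0..s, trajectory p x 2))
      (Metric.closedBall 0 r)) ∧
    (∃ K' : NNReal, LipschitzOnWith K' (fun p => trajectory p (e p) 1)
      (Metric.closedBall 0 r)) := by
  have hl := hb.four_le
  have hC := hb.C_nonneg
  have he' : ∀ p ∈ Metric.closedBall 0 r, e p ∈ Set.Icc 0 (l + 1) := fun p hp =>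
    ⟨by linarith [(he p hp).1], by linarith [(he p hp).2]⟩
  have hbd := hb.abs_le_two
  have hd := hb.dist_le
  have hT : 0 ≤ l + 1 := by linarith
  have hprod : ∀ i j, ∀ p ∈ Metric.closedBall (0 : ℝ × ℝ) r,
      ∀ q ∈ Metric.closedBall (0 : ℝ × ℝ) r, ∀ s ∈ Set.Icc 0 (l + 1),
      |trajectory p s i * trajectory p s j - trajectory q s i * trajectory q s j| ≤
        4 * C * dist p q := fun i j p hp q hq s hs => by
    rw [mul_assoc]
    exact abs_mul_sub_mul_le (hbd p hp s hs i) (hbd q hq s hs j) (hd p hp q hq s hs i)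
      (hd p hp q hq s hs j)
  have hprodbd : ∀ i j, ∀ p ∈ Metric.closedBall (0 : ℝ × ℝ) r, ∀ s ∈ Set.Icc 0 (l + 1),
      |trajectory p s i * trajectory p s j| ≤ 4 := fun i j p hp s hs => by
    rw [abs_mul]
    exact (mul_le_mul (hbd p hp s hs i) (hbd p hp s hs j) (abs_nonneg _) (by norm_num)).trans
      (by norm_num)
  refine ⟨?_, ?_, ?_, ?_, ?_⟩
  · refine exists_lipschitzOnWith_integral (M := 4) (C := 4 * C) (by norm_num) (by positivity) hT
      (fun p _ => ((continuous_trajectory p 2).pow 2).div_const 2) (fun p hp s hs => ?_)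
      (fun p hp q hq s hs => ?_) he' hK
    · have := hprodbd 2 2 p hp s hs
      rw [← pow_two] at this
      rw [abs_div, abs_two]
      linarith [abs_nonneg (trajectory p s 2 ^ 2)]
    · have := hprod 2 2 p hp q hq s hs
      rw [← pow_two, ← pow_two] at this
      rw [← sub_div, abs_div, abs_two]
      linarith [abs_nonneg (trajectory p s 2 ^ 2 - trajectory q s 2 ^ 2)]
  · refine exists_lipschitzOnWith_integral (M := 4) (C := 4 * C) (by norm_num) (by positivity) hT
      (fun p _ => (continuous_trajectory p 1).pow 2) (fun p hp s hs => ?_)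
      (fun p hp q hq s hs => ?_) he' hK
    · simpa only [pow_two] using hprodbd 1 1 p hp s hs
    · simpa only [pow_two] using hprod 1 1 p hp q hq s hs
  · exact exists_lipschitzOnWith_integral (M := 2) (C := C) (by norm_num) hC hT
      (fun p _ => continuous_trajectory p 2) (fun p hp s hs => hbd p hp s hs 2)
      (fun p hp q hq s hs => hd p hp q hq s hs 2) he' hK
  · refine exists_lipschitzOnWith_integral (M := 1) (C := C * (l + 1)) (by norm_num) (by positivity)
      hT (fun p _ => Real.continuous_cos.comp (intervalIntegral.continuous_primitive
        (fun a b => (continuous_trajectory p 2).intervalIntegrable a b) 0))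
      (fun p _ s _ => Real.abs_cos_le_one _) (fun p hp q hq s hs => ?_) he' hK
    have h1 : (∫ x in 0..s, trajectory p x 2) - ∫ x in 0..s, trajectory q x 2 =
        ∫ x in 0..s, (trajectory p x 2 - trajectory q x 2) :=
      (intervalIntegral.integral_sub ((continuous_trajectory p 2).intervalIntegrable _ _)
        ((continuous_trajectory q 2).intervalIntegrable _ _)).symm
    have h2 := intervalIntegral.norm_integral_le_of_norm_le_const (a := 0) (b := s)
      (f := fun x => trajectory p x 2 - trajectory q x 2) (C := C * dist p q) fun x hx => by
        rw [Set.uIoc_of_le hs.1] at hx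
        exact hd p hp q hq x ⟨hx.1.le, hx.2.trans hs.2⟩ 2
    rw [← h1, sub_zero, abs_of_nonneg hs.1, Real.norm_eq_abs] at h2
    have h3 := Real.lipschitzWith_cos.dist_le_mul (∫ x in 0..s, trajectory p x 2)
      (∫ x in 0..s, trajectory q x 2)
    rw [NNReal.coe_one, one_mul, Real.dist_eq, Real.dist_eq] at h3
    have h4 : C * dist p q * s ≤ C * dist p q * (l + 1) :=
      mul_le_mul_of_nonneg_left hs.2 (mul_nonneg hC dist_nonneg)
    linarith
  -- The endpoint value of `v` is itself an integral: `v' = -k u` and `v 0 = 1` give `1 - v = ∫ k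
  -- u`.
  · obtain ⟨K', hK'⟩ := exists_lipschitzOnWith_integral (M := 4) (C := 4 * C)
      (g := fun p s => trajectory p s 2 * trajectory p s 0) (by norm_num) (by positivity) hT
      (fun p _ => (continuous_trajectory p 2).mul (continuous_trajectory p 0))
      (hprodbd 2 0) (hprod 2 0) he' hK
    refine ⟨K', LipschitzOnWith.of_dist_le_mul fun p hp q hq => ?_⟩
    have hint : ∀ p ∈ Metric.closedBall (0 : ℝ × ℝ) r,
        ∫ s in 0..e p, trajectory p s 2 * trajectory p s 0 = 1 - trajectory p (e p) 1 := by
      intro p hp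
      have h := intervalIntegral.integral_eq_sub_of_hasDerivAt (a := 0) (b := e p)
        (f := fun s => -trajectory p s 1) (f' := fun s => trajectory p s 2 * trajectory p s 0)
        (fun s hs => by
          rw [Set.uIcc_of_le (he' p hp).1] at hs
          simpa using (hasDerivAt_trajectory_one
            (hbd p hp s ⟨hs.1, hs.2.trans (he' p hp).2⟩)).fun_neg)
        (((continuous_trajectory p 2).mul (continuous_trajectory p 0)).intervalIntegrable _ _)
      rw [h, trajectory_zero]
      simp [initialValue]
      ring
    have := hK'.dist_le_mul p hp q hq
    simp only [hint p hp, hint q hq] at this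
    rwa [dist_sub_left] at this

end UniformBounds

/-! ### Shooting for the second line of reflection -/

open Topology in
/-- Trajectories that meet two lines of reflection at a small angle. -/
theorem eventually_exists_half_period : ∀ᶠ t : ℝ in 𝓝[>] 0, ∃ (p : ℝ × ℝ) (l : ℝ),
    0 < p.1 ∧ 0 < p.2 ∧ 0 < l ∧ (∀ s ∈ Set.Icc 0 l, ∀ i, |trajectory p s i| ≤ 2) ∧
    trajectory p l 0 = 0 ∧ trajectory p l 3 = 0 ∧ 0 < trajectory p l 1 ∧
    (∀ s ∈ Set.Ioo 0 l, 0 < trajectory p s 0) ∧ |∫ s in 0..l, trajectory p s 2| < 1 ∧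
    Real.sin (∫ s in 0..l, trajectory p s 2) = -t := by
  obtain ⟨l, C, r, hb⟩ := exists_uniformBounds
  obtain ⟨e, K, he, hK, he0⟩ := hb.exists_endTime
  have hl := hb.four_le
  set S := Metric.closedBall (0 : ℝ × ℝ) r with hS
  have hS0 : S ∈ 𝓝 (0 : ℝ × ℝ) := Metric.closedBall_mem_nhds _ hb.r_pos
  obtain ⟨⟨KA, hA⟩, ⟨KB, hB⟩, ⟨KΘ, hΘ⟩, ⟨KX, hX⟩, ⟨Kv, hv⟩⟩ :=
    hb.exists_lipschitzOnWith_of_endTime (fun p hp => (he p hp).1) hK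
  set A : ℝ × ℝ → ℝ := fun p => ∫ s in 0..e p, trajectory p s 2 ^ 2 / 2 with hAdef
  set B : ℝ × ℝ → ℝ := fun p => ∫ s in 0..e p, trajectory p s 1 ^ 2 with hBdef
  set Θ : ℝ × ℝ → ℝ := fun p => ∫ s in 0..e p, trajectory p s 2 with hΘdef
  set X : ℝ × ℝ → ℝ := fun p => ∫ s in 0..e p, Real.cos (∫ x in 0..s, trajectory p x 2) with hXdef
  set v : ℝ × ℝ → ℝ := fun p => trajectory p (e p) 1 with hvdef
  have hA0 : 0 < A 0 := by simp only [hAdef, he0]; exact hb.base_curvature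
  have hB0 : 0 < B 0 := by simp only [hBdef, he0]; exact hb.base_normal
  have hX0 : 0 < X 0 := by simp only [hXdef, he0]; exact hb.base_cos
  have hΘ0 : Θ 0 = 0 := by simp only [hΘdef, he0]; exact hb.base_angle
  have evpos : ∀ {f : ℝ × ℝ → ℝ} {K : NNReal}, LipschitzOnWith K f S → 0 < f 0 →
      ∀ᶠ p in 𝓝 (0 : ℝ × ℝ), 0 < f p := fun hf hf0 =>
    (hf.continuousOn.continuousAt hS0).eventually (lt_mem_nhds hf0)
  have evΘ : ∀ᶠ p in 𝓝 (0 : ℝ × ℝ), |Θ p| < 1 := by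
    have h1 : |Θ 0| < 1 := by rw [hΘ0, abs_zero]; exact one_pos
    exact (hΘ.continuousOn.continuousAt hS0).abs.eventually (gt_mem_nhds h1)
  -- With `y = (A, B, X, v)`, this solves `δ X = t v` and `ε B = δ A` for `(ε, δ) / t`.
  let G : ℝ × ℝ × ℝ × ℝ → ℝ × ℝ := fun y => (y.1 / y.2.1 * (y.2.2.2 / y.2.2.1), y.2.2.2 / y.2.2.1)
  let Q : ℝ × ℝ → ℝ × ℝ × ℝ × ℝ := fun p => (A p, B p, X p, v p)
  have hQ := hA.prodMk (hB.prodMk (hX.prodMk hv))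
  have hG : ContDiffAt ℝ 1 G (Q 0) := by
    have h1 : (Q 0).2.1 ≠ 0 := hB0.ne'
    have h2 : (Q 0).2.2.1 ≠ 0 := hX0.ne'
    refine ContDiffAt.prodMk (ContDiffAt.mul (ContDiffAt.div ?_ ?_ h1) (ContDiffAt.div ?_ ?_ h2))
      (ContDiffAt.div ?_ ?_ h2) <;> fun_prop
  obtain ⟨KG, SG, hSG, hGlip⟩ := hG.exists_lipschitzOnWith
  have hQc : ContinuousAt Q 0 := hQ.continuousOn.continuousAt hS0
  have hpre : Q ⁻¹' SG ∈ 𝓝 (0 : ℝ × ℝ) := hQc hSG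
  have hh : LipschitzOnWith (KG * max KA (max KB (max KX Kv))) (G ∘ Q) (S ∩ Q ⁻¹' SG) :=
    hGlip.comp (hQ.mono Set.inter_subset_left) fun p hp => hp.2
  have hU : {p | p ∈ S ∧ 0 < A p ∧ 0 < B p ∧ 0 < X p ∧ |Θ p| < 1} ∈ 𝓝 (0 : ℝ × ℝ) := by
    filter_upwards [hS0, evpos hA hA0, evpos hB hB0, evpos hX hX0, evΘ] with p h1 h2 h3 h4 h5
    exact ⟨h1, h2, h3, h4, h5⟩
  have hev := eventually_exists_eq_smul_of_lipschitzOnWith (Filter.inter_mem hS0 hpre) hU hh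
  filter_upwards [hev.filter_mono nhdsWithin_le_nhds, self_mem_nhdsWithin] with t ht htpos
  obtain ⟨p, ⟨hpS, hAp, hBp, hXp, hΘp⟩, hp⟩ := ht
  replace htpos : 0 < t := htpos
  have hvp : 0 < v p := by
    have := (hb.near_end p hpS (e p) (he p hpS).1).2
    simp only [hvdef]
    linarith
  have hp2 : p.2 = t * (v p / X p) := congrArg Prod.snd hp
  have hp1 : p.1 = t * (A p / B p * (v p / X p)) := congrArg Prod.fst hp
  have he1 := (he p hpS).1
  have hepos : 0 < e p := by linarith [he1.1]
  have hbd : ∀ s ∈ Set.Icc 0 (e p), ∀ i, |trajectory p s i| ≤ 2 := fun s hs =>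
    hb.abs_le_two p hpS s ⟨hs.1, by linarith [hs.2, he1.2]⟩
  have hu : trajectory p (e p) 0 = 0 := by
    have hcA : Continuous fun s => trajectory p s 2 ^ 2 / 2 := ((continuous_trajectory p 2).pow 2).div_const 2
    have hcB : Continuous fun s => trajectory p s 1 ^ 2 := (continuous_trajectory p 1).pow 2
    -- The quantity `k² u / 2 + a v` vanishes at time `0`, and its increment is `δ A - ε B = 0`. As
    -- `a` vanishes at the end, so does `k² u / 2`, and `k ≠ 0` there.
    have h1 := intervalIntegral.integral_eq_sub_of_hasDerivAt (a := 0) (b := e p)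
      (f := fun s => trajectory p s 2 ^ 2 / 2 * trajectory p s 0 +
        trajectory p s 3 * trajectory p s 1)
      (f' := fun s => p.2 * (trajectory p s 2 ^ 2 / 2) - p.1 * trajectory p s 1 ^ 2)
      (fun s hs => by
        rw [Set.uIcc_of_le hepos.le] at hs
        have hs' := hbd s hs
        exact (((((hasDerivAt_trajectory_two hs').fun_pow 2).div_const 2).mul
          (hasDerivAt_trajectory_zero hs')).add ((hasDerivAt_trajectory_three hs').mul
          (hasDerivAt_trajectory_one hs'))).congr_deriv (by push_cast; ring))
      ((hcA.const_mul _).sub (hcB.const_mul _) |>.intervalIntegrable _ _)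
    rw [intervalIntegral.integral_sub ((hcA.const_mul _).intervalIntegrable _ _)
      ((hcB.const_mul _).intervalIntegrable _ _), intervalIntegral.integral_const_mul,
      intervalIntegral.integral_const_mul, (he p hpS).2] at h1
    have h2 : p.2 * A p - p.1 * B p = 0 := by
      rw [hp1, hp2]; field_simp; ring
    change p.2 * A p - p.1 * B p = _ at h1
    rw [h2, trajectory_zero] at h1
    simp only [initialValue, Matrix.cons_val, mul_zero, zero_mul, add_zero, sub_zero] at h1
    have h3 := (hb.near_end p hpS (e p) he1).1
    have h4 : trajectory p (e p) 2 ≠ 0 := by linarith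
    rcases mul_eq_zero.1 h1.symm with h5 | h5
    · exact absurd (by simpa using h5) h4
    · exact h5
  have hsin : Real.sin (Θ p) = -t := by
    set θ : ℝ → ℝ := fun s => ∫ x in 0..s, trajectory p x 2 with hθ
    have hθ' : ∀ s, HasDerivAt θ (trajectory p s 2) s := fun s =>
      ((continuous_trajectory p 2).integral_hasStrictDerivAt 0 s).hasDerivAt
    have hθc : Continuous θ := continuous_iff_continuousAt.2 fun s => (hθ' s).continuousAt
    -- The first coordinate of `P = (u + i v) exp (i θ)` has derivative `δ cos θ`. It vanishes at
    -- the start and equals `-v sin Θ` at the end.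
    have h1 := intervalIntegral.integral_eq_sub_of_hasDerivAt (a := 0) (b := e p)
      (f := fun s => trajectory p s 0 * Real.cos (θ s) - trajectory p s 1 * Real.sin (θ s))
      (f' := fun s => p.2 * Real.cos (θ s))
      (fun s hs => by
        rw [Set.uIcc_of_le hepos.le] at hs
        have hs' := hbd s hs
        exact (((hasDerivAt_trajectory_zero hs').mul (hθ' s).cos).sub
          ((hasDerivAt_trajectory_one hs').mul (hθ' s).sin)).congr_deriv (by ring))
      (((Real.continuous_cos.comp hθc).const_mul _).intervalIntegrable _ _)
    rw [intervalIntegral.integral_const_mul, hu, trajectory_zero] at h1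
    have h2 : θ 0 = 0 := by simp [hθ]
    simp only [initialValue, Matrix.cons_val, h2, Real.sin_zero, zero_mul, mul_zero,
      sub_zero, zero_sub] at h1
    change p.2 * X p = -(v p * Real.sin (Θ p)) at h1
    rw [hp2] at h1
    have h3 : t * (v p / X p) * X p = t * v p := by field_simp
    rw [h3] at h1
    have h4 : v p * (Real.sin (Θ p) + t) = 0 := by linarith
    rcases mul_eq_zero.1 h4 with h5 | h5
    · exact absurd h5 hvp.ne'
    · linarith
  refine ⟨p, e p, ?_, ?_, hepos, hbd, hu, (he p hpS).2, hvp, hb.pos_of_mem_Ioo hpS he1 hu, hΘp, hsin⟩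
  · rw [hp1]; positivity
  · rw [hp2]; positivity

/-! ### Reflection symmetry and the closed-up profile -/

/-- The signs of the time reversal symmetry of `frameField`. -/
def reversalSign : Fin 6 → ℝ := ![-1, 1, 1, -1, 1, 1]

theorem clippedField_reversal (x : Fin 6 → ℝ) (i : Fin 6) :
    clippedField (fun j => reversalSign j * x j) i = -(reversalSign i * clippedField x i) := by
  fin_cases i <;> simp [clippedField, frameField, reversalSign, clip_neg]
  ring

/-- The reversal fixes the value at time `c` precisely because `u` and `a` vanish there; uniqueness
does the rest. -/
theorem trajectory_reversal {p : ℝ × ℝ} {c : ℝ} (h0 : trajectory p c 0 = 0)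
    (h3 : trajectory p c 3 = 0) (s : ℝ) (i : Fin 6) :
    trajectory p (2 * c - s) i = reversalSign i * trajectory p s i := by
  have hy : (fun s i => reversalSign i * trajectory p (2 * c - s) i) = trajectory p := by
    refine eq_flow_of_hasDerivAt (t₀ := c) (fun t => ?_) (funext fun i => ?_)
    · rw [hasDerivAt_pi]
      intro i
      rw [clippedField_reversal]
      exact (((hasDerivAt_flow_apply (initialValue p) (2 * c - t) i).comp_const_sub (2 * c)
        t).const_mul (reversalSign i)).congr_deriv (by rw [mul_neg]; rfl)
    · have hc : 2 * c - c = c := by ring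
      change reversalSign i * trajectory p (2 * c - c) i = trajectory p c i
      rw [hc]
      fin_cases i <;> simp [reversalSign, h0, h3]
  have h := congrFun (congrFun hy s) i
  have hsq : reversalSign i * reversalSign i = 1 := by
    fin_cases i <;> simp [reversalSign]
  rw [← h, ← mul_assoc, hsq, one_mul]

/-- A profile curve with unit tangent `exp (i θ)` and curvature `k`, that solves the equation of
homothetic expanders and is symmetric under a reflection and the rotation through `2 Θ`; the points
at maximal distance from the origin form one orbit of the rotation. -/
structure IsProfile (γ : ℝ → ℂ) (θ k a : ℝ → ℝ) (σ l Θ : ℝ) : Prop where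
  σ_pos : 0 < σ
  l_pos : 0 < l
  curve : ∀ s, HasDerivAt γ (Complex.exp (θ s * Complex.I)) s
  angle : ∀ s, HasDerivAt θ (k s) s
  curv : ∀ s, HasDerivAt k (a s) s
  equation : ∀ s, HasDerivAt a
    (-(k s ^ 3 / 2) - σ * inner ℝ (γ s) (Complex.I * Complex.exp (θ s * Complex.I))) s
  rot : ∀ s, γ (s + 2 * l) = Complex.exp ((2 * Θ : ℝ) * Complex.I) * γ s
  refl : ∀ s, γ (-s) = -(starRingEnd ℂ) (γ s)
  norm_le : ∀ s, ‖γ s‖ ≤ ‖γ l‖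
  eq_of_norm_eq : ∀ s, ‖γ s‖ = ‖γ l‖ → ∃ n : ℤ, s = l + n * (2 * l)
  ne_zero : γ l ≠ 0

/-- Reversal about `0` and about `l` extends the bounds from `[0, l]` to all times and makes the
frame data periodic with period `2 l`, while the angle grows by `2 Θ` per period. The curve is `γ =
P / δ`, with `σ = ε δ`. -/
theorem exists_isProfile {p : ℝ × ℝ} {l : ℝ} (hp1 : 0 < p.1) (hp2 : 0 < p.2) (hl : 0 < l)
    (hbd : ∀ s ∈ Set.Icc 0 l, ∀ i, |trajectory p s i| ≤ 2) (hu : trajectory p l 0 = 0)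
    (ha : trajectory p l 3 = 0) (hv : 0 < trajectory p l 1)
    (hpos : ∀ s ∈ Set.Ioo 0 l, 0 < trajectory p s 0) :
    ∃ γ θ k a σ, IsProfile γ θ k a σ l (∫ s in 0..l, trajectory p s 2) := by
  have hneg : ∀ s i, trajectory p (-s) i = reversalSign i * trajectory p s i := fun s i => by
    have := trajectory_reversal (p := p) (c := 0) (by simp [trajectory_zero, initialValue])
      (by simp [trajectory_zero, initialValue]) s i
    rwa [mul_zero, zero_sub] at this
  have hrev := trajectory_reversal hu ha
  have hper : ∀ i, Function.Periodic (fun s => trajectory p s i) (2 * l) := fun i s => by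
    have h1 := hrev (-s) i
    rw [hneg, ← mul_assoc, sub_neg_eq_add, add_comm] at h1
    have hsq : reversalSign i * reversalSign i = 1 := by
      fin_cases i <;> simp [reversalSign]
    rwa [hsq, one_mul] at h1
  have hred : ∀ s : ℝ, ∃ n : ℤ, |s - n * (2 * l)| ≤ l := fun s => by
    refine ⟨round (s / (2 * l)), ?_⟩
    have h1 := abs_sub_round (s / (2 * l))
    have h2 : s - round (s / (2 * l)) * (2 * l) = (s / (2 * l) - round (s / (2 * l))) * (2 * l) := by
      field_simp
    rw [h2, abs_mul, abs_of_pos (by linarith : 0 < 2 * l)]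
    nlinarith
  have hbd' : ∀ s i, |trajectory p s i| ≤ 2 := fun s i => by
    obtain ⟨n, hn⟩ := hred s
    have h1 : trajectory p (s - n * (2 * l)) i = trajectory p s i := (hper i).sub_int_mul_eq n
    rw [← h1]
    have h2 := hbd _ ⟨abs_nonneg _, hn⟩ i
    rcases abs_cases (s - n * (2 * l)) with ⟨h, -⟩ | ⟨h, -⟩ <;> rw [h] at h2
    · exact h2
    · rw [hneg, abs_mul] at h2
      have : |reversalSign i| = 1 := by
        fin_cases i <;> simp [reversalSign]
      rwa [this, one_mul] at h2
  have hu' := fun s => hasDerivAt_trajectory_zero (hbd' s)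
  have hv' := fun s => hasDerivAt_trajectory_one (hbd' s)
  have hk' := fun s => hasDerivAt_trajectory_two (hbd' s)
  have ha' := fun s => hasDerivAt_trajectory_three (hbd' s)
  set u : ℝ → ℝ := fun s => trajectory p s 0 with hudef
  set v : ℝ → ℝ := fun s => trajectory p s 1 with hvdef
  set k : ℝ → ℝ := fun s => trajectory p s 2 with hkdef
  set a : ℝ → ℝ := fun s => trajectory p s 3 with hadef
  change ∀ s, HasDerivAt u (p.2 + k s * v s) s at hu'
  change ∀ s, HasDerivAt v (-(k s * u s)) s at hv'
  change ∀ s, HasDerivAt k (a s) s at hk'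
  change ∀ s, HasDerivAt a (-(k s ^ 3 / 2) - p.1 * v s) s at ha'
  have hun : ∀ s, u (-s) = -u s := fun s => by simpa [reversalSign] using hneg s 0
  have hvn : ∀ s, v (-s) = v s := fun s => by simpa [reversalSign] using hneg s 1
  have hkn : ∀ s, k (-s) = k s := fun s => by simpa [reversalSign] using hneg s 2
  have hkr : ∀ s, k (2 * l - s) = k s := fun s => by simpa [reversalSign] using hrev s 2
  set θ : ℝ → ℝ := fun s => ∫ x in 0..s, k x with hθdef
  have hθ' : ∀ s, HasDerivAt θ (k s) s := fun s =>
    ((continuous_trajectory p 2).integral_hasStrictDerivAt 0 s).hasDerivAt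
  have hθ0 : θ 0 = 0 := by simp [hθdef]
  have hθn : ∀ s, θ (-s) = -θ s := fun s => by
    have h1 : ∀ s, HasDerivAt (fun s => θ (-s) + θ s) 0 s := fun s =>
      (((hθ' (-s)).comp s (hasDerivAt_neg s)).add (hθ' s)).congr_deriv (by rw [hkn]; ring)
    have h2 := is_const_of_deriv_eq_zero (fun s => (h1 s).differentiableAt)
      (fun s => (h1 s).deriv) s 0
    simp only [neg_zero, hθ0, add_zero] at h2
    linarith
  have hθr : ∀ s, θ (2 * l - s) + θ s = 2 * θ l := fun s => by
    have h1 : ∀ s, HasDerivAt (fun s => θ (2 * l - s) + θ s) 0 s := fun s =>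
      ((hθ' (2 * l - s)).comp_const_sub (2 * l) s |>.add (hθ' s)).congr_deriv (by rw [hkr]; ring)
    have h2 := is_const_of_deriv_eq_zero (fun s => (h1 s).differentiableAt)
      (fun s => (h1 s).deriv) s l
    rw [h2, show 2 * l - l = l by ring]
    ring
  have hθp : ∀ s, θ (s + 2 * l) = θ s + 2 * θ l := fun s => by
    have := hθr (-s)
    rw [hθn, sub_neg_eq_add, add_comm (2 * l)] at this
    linarith
  let γ : ℝ → ℂ := fun s => (p.2 : ℂ)⁻¹ * ((u s + v s * Complex.I) * Complex.exp (θ s * Complex.I))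
  have hδ : (p.2 : ℂ) ≠ 0 := by exact_mod_cast hp2.ne'
  have hexp : ∀ s, ‖Complex.exp (θ s * Complex.I)‖ = 1 := fun s => Complex.norm_exp_ofReal_mul_I _
  let N : ℝ → ℝ := fun s => u s ^ 2 + v s ^ 2
  have hnorm : ∀ s, ‖γ s‖ = p.2⁻¹ * √(N s) := fun s => by
    simp only [γ, N]
    rw [norm_mul, norm_mul, hexp, mul_one, norm_inv, Complex.norm_real, Real.norm_of_nonneg hp2.le,
      Complex.norm_add_mul_I]
  have hNn : ∀ s, N (-s) = N s := fun s => by simp only [N, hun, hvn]; ring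
  have hNp : Function.Periodic N (2 * l) := fun s => by
    have h1 : u (s + 2 * l) = u s := hper 0 s
    have h2 : v (s + 2 * l) = v s := hper 1 s
    simp only [N, h1, h2]
  -- As `N = |P|²` is even, has period `2 l` and increases on `[0, l]`, its maxima are exactly the
  -- odd multiples of `l`.
  have hNmono : StrictMonoOn N (Set.Icc 0 l) := by
    have h1 : ∀ s, HasDerivAt N (2 * p.2 * u s) s := fun s =>
      (((hu' s).fun_pow 2).add ((hv' s).fun_pow 2)).congr_deriv (by push_cast; ring)
    refine strictMonoOn_of_deriv_pos (convex_Icc _ _)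
      (fun s _ => (h1 s).continuousAt.continuousWithinAt) fun s hs => ?_
    rw [interior_Icc] at hs
    rw [(h1 s).deriv]
    have := hpos s hs
    positivity
  have hN : ∀ s, N s ≤ N l ∧ (N s = N l → ∃ n : ℤ, s = l + n * (2 * l)) := fun s => by
    obtain ⟨n, hn⟩ := hred s
    have h1 : N |s - n * (2 * l)| = N s := by
      rcases abs_cases (s - n * (2 * l)) with ⟨h, -⟩ | ⟨h, -⟩ <;> rw [h]
      · exact hNp.sub_int_mul_eq n
      · rw [hNn]; exact hNp.sub_int_mul_eq n
    have hmem : |s - n * (2 * l)| ∈ Set.Icc 0 l := ⟨abs_nonneg _, hn⟩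
    rw [← h1]
    refine ⟨hNmono.monotoneOn hmem ⟨hl.le, le_rfl⟩ hn, fun h => ?_⟩
    have h2 := hNmono.injOn hmem ⟨hl.le, le_rfl⟩ h
    rcases abs_cases (s - n * (2 * l)) with ⟨h, -⟩ | ⟨h, -⟩ <;> rw [h] at h2
    · exact ⟨n, by linarith⟩
    · exact ⟨n - 1, by push_cast; linarith⟩
  have hNpos : 0 < N l := by
    have : 0 < v l := hv
    simp only [N]
    positivity
  refine ⟨γ, θ, k, a, p.1 * p.2, by positivity, hl, fun s => ?_, hθ', hk', fun s => ?_, fun s => ?_,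
    fun s => ?_, fun s => ?_, fun s h => ?_, ?_⟩
  · have h1 := (((hu' s).ofReal_comp).add (((hv' s).ofReal_comp).mul_const Complex.I)).mul
      (((hθ' s).ofReal_comp.mul_const Complex.I).cexp)
    refine (h1.const_mul (p.2 : ℂ)⁻¹).congr_deriv ?_
    simp only [Pi.add_apply]
    push_cast
    have hc : (p.2 : ℂ)⁻¹ * p.2 = 1 := inv_mul_cancel₀ hδ
    linear_combination Complex.exp (θ s * Complex.I) * hc +
      ((p.2 : ℂ)⁻¹ * k s * v s * Complex.exp (θ s * Complex.I)) * Complex.I_sq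
  · have h1 : inner ℝ (γ s) (Complex.I * Complex.exp (θ s * Complex.I)) = p.2⁻¹ * v s := by
      have h2 : Complex.exp (θ s * Complex.I) * (starRingEnd ℂ) (Complex.exp (θ s * Complex.I)) = 1 := by
        rw [Complex.mul_conj, Complex.normSq_eq_norm_sq, hexp]
        simp
      have h3 : Complex.I * Complex.exp (θ s * Complex.I) * (starRingEnd ℂ) (γ s) =
          (p.2 : ℂ)⁻¹ * (v s + u s * Complex.I) := by
        simp only [γ, map_mul, map_add, map_inv₀, Complex.conj_ofReal, Complex.conj_I]
        linear_combination ((p.2 : ℂ)⁻¹ * (u s * Complex.I - v s * Complex.I * Complex.I)) * h2 -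
          (p.2 : ℂ)⁻¹ * v s * Complex.I_sq
      rw [Complex.inner, h3, ← Complex.ofReal_inv, Complex.re_ofReal_mul]
      simp
    rw [h1]
    refine (ha' s).congr_deriv ?_
    field_simp
  · have h1 : u (s + 2 * l) = u s := hper 0 s
    have h2 : v (s + 2 * l) = v s := hper 1 s
    have h3 : Complex.exp ((θ s + 2 * θ l : ℝ) * Complex.I) =
        Complex.exp ((2 * θ l : ℝ) * Complex.I) * Complex.exp (θ s * Complex.I) := by
      rw [← Complex.exp_add]
      push_cast
      ring_nf
    change γ (s + 2 * l) = Complex.exp ((2 * θ l : ℝ) * Complex.I) * γ s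
    simp only [γ, h1, h2, hθp, h3]
    ring
  · simp only [γ, hun, hvn, hθn, map_mul, map_add, map_inv₀, Complex.conj_ofReal, Complex.conj_I,
      ← Complex.exp_conj]
    push_cast
    ring_nf
  · rw [hnorm, hnorm]
    gcongr
    exact (hN s).1
  · rw [hnorm, hnorm] at h
    have h1 := mul_left_cancel₀ (inv_pos.2 hp2).ne' h
    refine (hN s).2 ((Real.sqrt_inj ?_ hNpos.le).1 h1)
    simp only [N]
    positivity
  · rw [← norm_pos_iff, hnorm]
    positivity

/-! ### Scaling and the expanding solution of the flow -/

theorem arcDeriv_const_mul_curve {E : Type*} [NormedAddCommGroup E] [NormedSpace ℝ E]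
    {c : ℝ} (hc : 0 < c) (γ : ℝ → ℂ) (f : ℝ → E) :
    arcDeriv (fun u => (c : ℂ) * γ u) f = fun u => c⁻¹ • arcDeriv γ f u := by
  funext u
  rw [arcDeriv, arcDeriv, deriv_const_mul_field, norm_mul, Complex.norm_real,
    Real.norm_of_nonneg hc.le, mul_inv, mul_smul]

theorem unitTangent_const_mul {c : ℝ} (hc : 0 < c) (γ : ℝ → ℂ) :
    unitTangent (fun u => (c : ℂ) * γ u) = unitTangent γ := by
  funext u
  rw [unitTangent, arcDeriv_const_mul_curve hc, unitTangent]
  simp only [arcDeriv]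
  rw [deriv_const_mul_field, Complex.real_smul, Complex.real_smul, Complex.real_smul]
  have : (c : ℂ) ≠ 0 := by exact_mod_cast hc.ne'
  push_cast
  field_simp

theorem unitNormal_const_mul {c : ℝ} (hc : 0 < c) (γ : ℝ → ℂ) :
    unitNormal (fun u => (c : ℂ) * γ u) = unitNormal γ := by
  funext u
  rw [unitNormal, unitTangent_const_mul hc, unitNormal]

theorem curvature_const_mul {c : ℝ} (hc : 0 < c) (γ : ℝ → ℂ) :
    curvature (fun u => (c : ℂ) * γ u) = fun u => c⁻¹ * curvature γ u := by
  funext u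
  rw [curvature, unitNormal_const_mul hc, unitTangent_const_mul hc, arcDeriv_const_mul_curve hc,
    real_inner_smul_left, curvature]

theorem elasticGradient_const_mul {c : ℝ} (hc : 0 < c) (γ : ℝ → ℂ) (u : ℝ) :
    elasticGradient (fun u => (c : ℂ) * γ u) u = (c ^ 3)⁻¹ * elasticGradient γ u := by
  have h : ∀ (d : ℝ) (f : ℝ → ℝ), arcDeriv γ (fun u => d * f u) = fun u => d * arcDeriv γ f u := by
    intro d f
    funext u
    rw [arcDeriv, arcDeriv, deriv_const_mul_field, smul_eq_mul, smul_eq_mul]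
    ring
  rw [elasticGradient, elasticGradient, curvature_const_mul hc, arcDeriv_const_mul_curve hc,
    arcDeriv_const_mul_curve hc, h]
  simp only [smul_eq_mul]
  rw [h, h]
  field_simp

/-- The solution of `ρ' = σ ρ⁻³` with `ρ 0 = 1`. -/
noncomputable def expansionFactor (σ t : ℝ) : ℝ := (1 + 4 * σ * t) ^ (1 / 4 : ℝ)

theorem expansionFactor_pos {σ t : ℝ} (hσ : 0 < σ) (ht : 0 ≤ t) : 0 < expansionFactor σ t :=
  Real.rpow_pos_of_pos (by positivity) _

theorem hasDerivAt_expansionFactor {σ t : ℝ} (hσ : 0 < σ) (ht : 0 ≤ t) :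
    HasDerivAt (expansionFactor σ) (σ * (expansionFactor σ t ^ 3)⁻¹) t := by
  have h0 : 0 < 1 + 4 * σ * t := by positivity
  have h1 : HasDerivAt (fun t => 1 + 4 * σ * t) (4 * σ) t := by
    simpa using ((hasDerivAt_id t).const_mul (4 * σ)).const_add 1
  refine (h1.rpow_const (p := 1 / 4) (Or.inl h0.ne')).congr_deriv ?_
  have h2 : expansionFactor σ t ^ 3 = (1 + 4 * σ * t) ^ (3 / 4 : ℝ) := by
    rw [expansionFactor, ← Real.rpow_natCast, ← Real.rpow_mul h0.le]
    norm_num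
  rw [h2, ← Real.rpow_neg h0.le, show (1 / 4 : ℝ) - 1 = -(3 / 4) by norm_num]
  ring

/-- The elastic gradient scales by `ρ⁻³` and the normal is unchanged, so the flow equation for `ρ γ`
reduces to `ρ' = σ ρ⁻³`. -/
theorem isHomotheticExpander_of_elasticGradient_eq {γ : ℝ → ℂ}
    (hγ : IsSmoothClosedImmersedCurve γ) {σ : ℝ} (hσ : 0 < σ)
    (h : ∀ u, elasticGradient γ u = -σ * inner ℝ (γ u) (unitNormal γ u)) :
    IsHomotheticExpander γ := by
  refine ⟨⟨σ, hσ, h⟩, expansionFactor σ, by simp [expansionFactor], ?_, ?_, ?_, ?_, ?_, ?_⟩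
  · intro x hx y hy hxy
    replace hx : 0 ≤ x := hx
    refine Real.rpow_lt_rpow (by positivity) ?_ (by norm_num)
    have := mul_lt_mul_of_pos_left hxy (by positivity : 0 < 4 * σ)
    linarith
  · refine (tendsto_rpow_atTop (by norm_num)).comp ?_
    exact Filter.tendsto_atTop_add_const_left _ _
      (Filter.tendsto_id.const_mul_atTop (by positivity))
  · have h1 : ContDiffOn ℝ (⊤ : ℕ∞) (fun p : ℝ × ℝ => expansionFactor σ p.1)
        (Set.Ici 0 ×ˢ Set.univ) := by
      refine ContDiffOn.rpow_const_of_ne (by fun_prop) fun p hp => ?_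
      have : 0 ≤ p.1 := hp.1
      positivity
    exact (Complex.ofRealCLM.contDiff.comp_contDiffOn h1).mul
      (hγ.smooth.comp contDiff_snd).contDiffOn
  · obtain ⟨T, hT, hper⟩ := hγ.closed
    exact ⟨T, hT, fun t _ u => by simp only [hper u]⟩
  · intro t ht u
    rw [deriv_const_mul_field]
    have := (expansionFactor_pos hσ ht).ne'
    exact mul_ne_zero (by exact_mod_cast this) (hγ.immersed u)
  · intro t ht u
    have hpos := expansionFactor_pos hσ ht
    refine ⟨((σ * (expansionFactor σ t ^ 3)⁻¹ : ℝ) : ℂ) * γ u, ?_, ?_⟩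
    · exact ((hasDerivAt_expansionFactor hσ ht).ofReal_comp.mul_const _).hasDerivWithinAt
    · rw [unitNormal_const_mul hpos, elasticGradient_const_mul hpos, h, ← Complex.real_smul,
        real_inner_smul_left]
      ring

/-! ### Smoothness, curvature and closing of the profile -/

namespace IsProfile

variable {γ : ℝ → ℂ} {θ k a : ℝ → ℝ} {σ l Θ : ℝ}

/-- A bootstrap: each of the four derivatives is a smooth expression in the four functions, so all
of them gain one order at a time. -/
theorem contDiff (h : IsProfile γ θ k a σ l Θ) : ContDiff ℝ (⊤ : ℕ∞) γ := by
  have key : ∀ n : ℕ, ContDiff ℝ n γ ∧ ContDiff ℝ n θ ∧ ContDiff ℝ n k ∧ ContDiff ℝ n a := by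
    intro n
    induction n with
    | zero =>
      simp only [Nat.cast_zero, contDiff_zero]
      exact ⟨continuous_iff_continuousAt.2 fun s => (h.curve s).continuousAt,
        continuous_iff_continuousAt.2 fun s => (h.angle s).continuousAt,
        continuous_iff_continuousAt.2 fun s => (h.curv s).continuousAt,
        continuous_iff_continuousAt.2 fun s => (h.equation s).continuousAt⟩
    | succ n ih =>
      obtain ⟨h1, h2, h3, h4⟩ := ih
      have hE : ContDiff ℝ n fun s => Complex.exp (θ s * Complex.I) :=
        ((Complex.ofRealCLM.contDiff.comp h2).mul contDiff_const).cexp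
      have step : ∀ {E : Type} [NormedAddCommGroup E] [NormedSpace ℝ E] {f f' : ℝ → E},
          (∀ s, HasDerivAt f (f' s) s) → ContDiff ℝ n f' → ContDiff ℝ (n + 1 : ℕ) f := by
        intro E _ _ f f' hf hf'
        push_cast
        rw [contDiff_succ_iff_deriv]
        refine ⟨fun s => (hf s).differentiableAt, by simp, ?_⟩
        rwa [show deriv f = f' from funext fun s => (hf s).deriv]
      refine ⟨step h.curve hE, step h.angle h3, step h.curv h4, step h.equation ?_⟩
      exact ((h3.pow 3).div_const 2).neg.sub
        (contDiff_const.mul (h1.inner ℝ (contDiff_const.mul hE)))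
  exact contDiff_infty.2 fun n => (key n).1

theorem deriv_curve (h : IsProfile γ θ k a σ l Θ) (s : ℝ) :
    deriv γ s = Complex.exp (θ s * Complex.I) := (h.curve s).deriv

theorem arcDeriv_eq (h : IsProfile γ θ k a σ l Θ) {E : Type*} [NormedAddCommGroup E]
    [NormedSpace ℝ E] (f : ℝ → E) : arcDeriv γ f = deriv f := by
  funext s
  rw [arcDeriv, h.deriv_curve, Complex.norm_exp_ofReal_mul_I, inv_one, one_smul]

theorem unitTangent_eq (h : IsProfile γ θ k a σ l Θ) :
    unitTangent γ = fun s => Complex.exp (θ s * Complex.I) := by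
  rw [unitTangent, h.arcDeriv_eq]
  exact funext h.deriv_curve

theorem curvature_eq (h : IsProfile γ θ k a σ l Θ) : curvature γ = k := by
  funext s
  rw [curvature, h.arcDeriv_eq, unitNormal, h.unitTangent_eq]
  have h1 : HasDerivAt (fun s => Complex.exp (θ s * Complex.I))
      (k s • (Complex.I * Complex.exp (θ s * Complex.I))) s := by
    refine ((h.angle s).ofReal_comp.mul_const Complex.I).cexp.congr_deriv ?_
    rw [Complex.real_smul]
    ring
  rw [h1.deriv, real_inner_smul_left, real_inner_self_eq_norm_sq, norm_mul, Complex.norm_I,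
    Complex.norm_exp_ofReal_mul_I]
  ring

theorem elasticGradient_eq (h : IsProfile γ θ k a σ l Θ) (u : ℝ) :
    elasticGradient γ u = -σ * inner ℝ (γ u) (unitNormal γ u) := by
  rw [elasticGradient, h.curvature_eq, h.arcDeriv_eq, h.arcDeriv_eq,
    show deriv k = a from funext fun s => (h.curv s).deriv, (h.equation u).deriv, unitNormal,
    h.unitTangent_eq]
  ring

theorem rot_zpow (h : IsProfile γ θ k a σ l Θ) (n : ℤ) (s : ℝ) :
    γ (s + n * (2 * l)) = Complex.exp ((2 * Θ : ℝ) * Complex.I) ^ n * γ s := by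
  have hne := Complex.exp_ne_zero ((2 * Θ : ℝ) * Complex.I)
  induction n with
  | zero => simp
  | succ n ih =>
    rw [show s + ((n + 1 : ℤ) : ℝ) * (2 * l) = s + (n : ℤ) * (2 * l) + 2 * l by push_cast; ring,
      h.rot, ih, zpow_add_one₀ hne]
    ring
  | pred n ih =>
    have h1 := h.rot (s + ((-n - 1 : ℤ) : ℝ) * (2 * l))
    rw [show s + ((-n - 1 : ℤ) : ℝ) * (2 * l) + 2 * l = s + ((-n : ℤ) : ℝ) * (2 * l) by
      push_cast; ring, ih] at h1
    rw [zpow_sub_one₀ hne, mul_comm _ (Complex.exp _)⁻¹, mul_assoc, h1, inv_mul_cancel_left₀ hne]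

theorem isSmoothClosedImmersedCurve (h : IsProfile γ θ k a σ l Θ) {m : ℕ} (hm : 0 < m)
    (hΘ : Complex.exp ((2 * Θ : ℝ) * Complex.I) ^ m = 1) : IsSmoothClosedImmersedCurve γ where
  smooth := h.contDiff
  closed := by
    have hl := h.l_pos
    refine ⟨m * (2 * l), by positivity, fun s => ?_⟩
    have := h.rot_zpow m s
    rwa [zpow_natCast, hΘ, one_mul, Int.cast_natCast] at this
  immersed u := by
    rw [h.deriv_curve]
    exact Complex.exp_ne_zero _

theorem isHomotheticExpander (h : IsProfile γ θ k a σ l Θ) {m : ℕ} (hm : 0 < m)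
    (hΘ : Complex.exp ((2 * Θ : ℝ) * Complex.I) ^ m = 1) : IsHomotheticExpander γ :=
  isHomotheticExpander_of_elasticGradient_eq (h.isSmoothClosedImmersedCurve hm hΘ) h.σ_pos
    h.elasticGradient_eq

end IsProfile

/-! ### The symmetry group -/

namespace IsProfile

variable {γ : ℝ → ℂ} {θ k a : ℝ → ℝ} {σ l Θ : ℝ}

/-- The image lies in the disc of radius `‖γ l‖` about the origin, hence also in the disc of this
radius about `Φ 0`. For each of the `m` extremal points this gives an inequality for `Φ 0`; these
points sum to zero, so adding the inequalities forces `Φ 0 = 0`. -/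
theorem map_zero_of_image_eq (h : IsProfile γ θ k a σ l Θ) {m : ℕ} (hm : 1 < m)
    (hω : IsPrimitiveRoot (Complex.exp ((2 * Θ : ℝ) * Complex.I)) m) {Φ : ℂ ≃ᵢ ℂ}
    (hΦ : Φ '' Set.range γ = Set.range γ) : Φ 0 = 0 := by
  set ω := Complex.exp ((2 * Θ : ℝ) * Complex.I) with hωdef
  have hωn : ‖ω‖ = 1 := Complex.norm_exp_ofReal_mul_I _
  set c := Φ 0 with hc
  have key : ∀ n : ℕ, ‖c‖ ^ 2 ≤ 2 * inner ℝ (ω ^ n * γ l) c := by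
    intro n
    have h1 : ω ^ n * γ l ∈ Φ '' Set.range γ := by
      rw [hΦ]
      exact ⟨l + (n : ℤ) * (2 * l), by rw [h.rot_zpow, zpow_natCast]⟩
    obtain ⟨_, ⟨s, rfl⟩, hs⟩ := h1
    have h2 : ‖ω ^ n * γ l - c‖ ≤ ‖γ l‖ := by
      rw [← hs, hc, ← dist_eq_norm, Φ.dist_eq, dist_zero_right]
      exact h.norm_le s
    have h3 : ‖ω ^ n * γ l‖ = ‖γ l‖ := by rw [norm_mul, norm_pow, hωn, one_pow, one_mul]
    have h4 := norm_sub_sq_real (ω ^ n * γ l) c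
    rw [h3] at h4
    nlinarith [norm_nonneg (ω ^ n * γ l - c)]
  have hsum : ∑ n ∈ Finset.range m, (2 * inner ℝ (ω ^ n * γ l) c) = 0 := by
    rw [← Finset.mul_sum, ← sum_inner, ← Finset.sum_mul, hω.geom_sum_eq_zero hm, zero_mul,
      inner_zero_left, mul_zero]
  have hle := Finset.sum_le_sum fun n (_ : n ∈ Finset.range m) => key n
  rw [hsum, Finset.sum_const, Finset.card_range, nsmul_eq_mul] at hle
  have hm' : (0 : ℝ) < m := by exact_mod_cast (zero_lt_one.trans hm)
  have h5 : ‖c‖ ^ 2 ≤ 0 := by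
    by_contra! hlt
    exact absurd (mul_pos hm' hlt) (not_lt.2 hle)
  have h6 : ‖c‖ = 0 := by
    have := pow_eq_zero_iff two_ne_zero |>.1 (le_antisymm h5 (sq_nonneg _))
    exact this
  exact norm_eq_zero.1 h6

/-- A symmetry fixes the origin and permutes the farthest points, which form one orbit of the
rotation. A linear isometry of the plane is determined by its orientation and the image of `γ l`. -/
theorem isometry_eq_of_image_eq (h : IsProfile γ θ k a σ l Θ) {m : ℕ} (hm : 1 < m)
    (hω : IsPrimitiveRoot (Complex.exp ((2 * Θ : ℝ) * Complex.I)) m) {Φ : ℂ ≃ᵢ ℂ}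
    (hΦ : Φ '' Set.range γ = Set.range γ) :
    (∃ n : ℤ, ∀ z, Φ z = Complex.exp ((2 * Θ : ℝ) * Complex.I) ^ n * z) ∨
    (∃ n : ℤ, ∀ z, Φ z = -(Complex.exp ((2 * Θ : ℝ) * Complex.I) ^ n * (starRingEnd ℂ) z)) := by
  set ω := Complex.exp ((2 * Θ : ℝ) * Complex.I) with hωdef
  have hω0 : ω ≠ 0 := Complex.exp_ne_zero _
  have h0 := h.map_zero_of_image_eq hm hω hΦ
  have hmax : ∃ n : ℤ, Φ (γ l) = ω ^ n * γ l := by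
    have h1 : Φ (γ l) ∈ Set.range γ := by
      rw [← hΦ]
      exact ⟨_, ⟨l, rfl⟩, rfl⟩
    obtain ⟨s, hs⟩ := h1
    have h2 : ‖γ s‖ = ‖γ l‖ := by
      rw [hs, ← dist_zero_right, ← h0, Φ.dist_eq, dist_zero_right]
    obtain ⟨n, rfl⟩ := h.eq_of_norm_eq s h2
    exact ⟨n, by rw [← hs, h.rot_zpow]⟩
  obtain ⟨n, hn⟩ := hmax
  obtain ⟨c, hc⟩ := linear_isometry_complex (Φ.toRealLinearIsometryEquivOfMapZero h0)
  have happ : ∀ z, Φ.toRealLinearIsometryEquivOfMapZero h0 z = Φ z := fun z => by simp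
  rcases hc with hc | hc
  · left
    have h3 : ∀ z, Φ z = c * z := fun z => by rw [← happ, hc, rotation_apply]
    refine ⟨n, fun z => ?_⟩
    rw [h3] at hn ⊢
    rw [mul_right_cancel₀ h.ne_zero hn]
  · right
    have h3 : ∀ z, Φ z = c * (starRingEnd ℂ) z := fun z => by
      rw [← happ, hc, LinearIsometryEquiv.trans_apply, rotation_apply, Complex.conjLIE_apply]
    -- The points at times `-l` and `l` are related both by the reflection and by one step of the
    -- rotation.
    have h4 : (starRingEnd ℂ) (γ l) = -(ω⁻¹ * γ l) := by
      have h5 := h.refl l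
      have h6 := h.rot (-l)
      rw [show -l + 2 * l = l by ring, h5] at h6
      have h7 : ω⁻¹ * γ l = -(starRingEnd ℂ) (γ l) := by
        rw [inv_mul_eq_iff_eq_mul₀ hω0]
        exact h6
      rw [h7, neg_neg]
    refine ⟨n + 1, fun z => ?_⟩
    have h7 : (c : ℂ) = -ω ^ (n + 1) := by
      rw [h3, h4] at hn
      have h8 : (-(c : ℂ) * ω⁻¹) * γ l = ω ^ n * γ l := by rw [← hn]; ring
      have h9 := mul_right_cancel₀ h.ne_zero h8
      rw [zpow_add_one₀ hω0, ← h9]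
      field_simp
    rw [h3, h7]
    ring

theorem iterate_eq_of_image_eq (h : IsProfile γ θ k a σ l Θ) {m : ℕ} (hm : 1 < m)
    (hω : IsPrimitiveRoot (Complex.exp ((2 * Θ : ℝ) * Complex.I)) m) {Φ : ℂ ≃ᵢ ℂ}
    (hΦ : Φ '' Set.range γ = Set.range γ) : Φ^[m] = id ∨ Φ^[2] = id := by
  set ω := Complex.exp ((2 * Θ : ℝ) * Complex.I) with hωdef
  rcases h.isometry_eq_of_image_eq hm hω hΦ with ⟨n, hn⟩ | ⟨n, hn⟩
  · left
    have h1 : ∀ j : ℕ, ∀ z, Φ^[j] z = (ω ^ n) ^ j * z := by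
      intro j
      induction j with
      | zero => simp
      | succ j ih =>
        intro z
        rw [Function.iterate_succ_apply', ih, hn, pow_succ, ← hωdef]
        ring
    funext z
    have h2 : (ω ^ n) ^ m = 1 := by
      rw [← zpow_natCast, ← zpow_mul, mul_comm n, zpow_mul, zpow_natCast, hω.pow_eq_one, one_zpow]
    rw [h1, h2, one_mul, id]
  · right
    funext z
    have h2 : ω ^ n * (starRingEnd ℂ) (ω ^ n) = 1 := by
      rw [Complex.mul_conj, Complex.normSq_eq_norm_sq, norm_zpow, hωdef,
        Complex.norm_exp_ofReal_mul_I]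
      simp
    simp only [Function.iterate_succ, Function.iterate_zero, Function.comp, id, hn]
    rw [map_neg, map_mul, Complex.conj_conj, ← hωdef]
    linear_combination z * h2

/-- Rotations about the origin, as isometries of the plane. -/
noncomputable def _root_.rotationIsometryHom : Circle →* (ℂ ≃ᵢ ℂ) where
  toFun c := (rotation c).toIsometryEquiv
  map_one' := by ext z; simp
  map_mul' c d := by ext z; simp [IsometryEquiv.mul_apply]

theorem rotation_image_range (h : IsProfile γ θ k a σ l Θ) {c : Circle}
    (hc : (c : ℂ) = Complex.exp ((2 * Θ : ℝ) * Complex.I) ^ (-1 : ℤ)) :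
    (rotation c).toIsometryEquiv '' Set.range γ = Set.range γ := by
  have hω0 : Complex.exp ((2 * Θ : ℝ) * Complex.I) ≠ 0 := Complex.exp_ne_zero _
  have hrot : ∀ z, (rotation c).toIsometryEquiv z = c * z := fun z => by simp
  ext z
  constructor
  · rintro ⟨_, ⟨s, rfl⟩, rfl⟩
    exact ⟨s + (-1 : ℤ) * (2 * l), by rw [h.rot_zpow, hrot, hc]⟩
  · rintro ⟨s, rfl⟩
    refine ⟨_, ⟨s + 2 * l, rfl⟩, ?_⟩
    rw [hrot, hc, h.rot, zpow_neg_one, inv_mul_cancel_left₀ hω0]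

theorem hasDihedralSymmetry (h : IsProfile γ θ k a σ l Θ) {m : ℕ} (hm : 1 < m)
    (hω : IsPrimitiveRoot (Complex.exp ((2 * Θ : ℝ) * Complex.I)) m)
    (hc : (Circle.exp (2 * Real.pi / m) : ℂ) =
      Complex.exp ((2 * Θ : ℝ) * Complex.I) ^ (-1 : ℤ)) :
    HasDihedralSymmetry m (Set.range γ) := by
  set ω := Complex.exp ((2 * Θ : ℝ) * Complex.I) with hωdef
  set c := Circle.exp (2 * Real.pi / m) with hcdef
  -- The axis is the imaginary line, `b = i`, so that `b² z̄ = -z̄`.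
  obtain ⟨b, hb⟩ : ∃ b : Circle, (b ^ 2 : Circle) = (-1 : ℂ) := by
    refine ⟨Circle.exp (Real.pi / 2), ?_⟩
    rw [← Circle.exp_nsmul]
    simp only [Circle.coe_exp, nsmul_eq_mul]
    push_cast
    rw [show (2 : ℂ) * (Real.pi / 2) * Complex.I = Real.pi * Complex.I by ring,
      Complex.exp_pi_mul_I]
  have hrefl : ∀ z, (lineReflection b).toIsometryEquiv z = -(starRingEnd ℂ) z := fun z => by
    change rotation (b ^ 2) (Complex.conjLIE z) = _
    rw [rotation_apply, hb, Complex.conjLIE_apply, neg_one_mul]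
  refine ⟨b, le_antisymm (fun Φ hΦ => ?_) ?_⟩
  · have hR : ∀ n : ℤ, rotationIsometryHom (c ^ n) ∈ dihedralSubgroup m b := fun n => by
      have h1 : rotationIsometryHom c ∈ dihedralSubgroup m b := Subgroup.subset_closure (Or.inl rfl)
      rw [map_zpow]
      exact Subgroup.zpow_mem _ h1 n
    have hRz : ∀ (n : ℤ) z, rotationIsometryHom (c ^ (-n)) z = ω ^ n * z := fun n z => by
      change rotation (c ^ (-n)) z = _
      rw [rotation_apply, Circle.coe_zpow, hc, ← zpow_mul]
      simp
    rcases h.isometry_eq_of_image_eq hm hω hΦ with ⟨n, hn⟩ | ⟨n, hn⟩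
    · have : Φ = rotationIsometryHom (c ^ (-n)) := by
        ext z
        rw [hn, hRz]
      rw [this]
      exact hR _
    · have : Φ = rotationIsometryHom (c ^ (-n)) * (lineReflection b).toIsometryEquiv := by
        ext z
        rw [hn, IsometryEquiv.mul_apply, hRz, hrefl, mul_neg]
      rw [this]
      have h1 : (lineReflection b).toIsometryEquiv ∈ dihedralSubgroup m b :=
        Subgroup.subset_closure (Or.inr rfl)
      exact Subgroup.mul_mem _ (hR _) h1
  · rw [dihedralSubgroup, Subgroup.closure_le]
    rintro Φ (rfl | rfl)
    · exact h.rotation_image_range hc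
    · change _ '' _ = _
      ext z
      constructor
      · rintro ⟨_, ⟨s, rfl⟩, rfl⟩
        exact ⟨-s, by rw [hrefl, h.refl]⟩
      · rintro ⟨s, rfl⟩
        exact ⟨_, ⟨-s, rfl⟩, by rw [hrefl, h.refl, map_neg, Complex.conj_conj, neg_neg]⟩

end IsProfile

/-! ### Similarity and the choice of the angle -/

theorem AreSimilar.symm {Γ Γ' : Set ℂ} (h : AreSimilar Γ Γ') : AreSimilar Γ' Γ := by
  obtain ⟨Φ, rfl⟩ := h
  refine ⟨Φ.symm, ?_⟩
  rw [← Set.image_comp]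
  simp

/-- Conjugating by a similarity turns isometries into isometries, because the dilation factors
cancel. -/
theorem AreSimilar.exists_conj {Γ Γ' : Set ℂ} (h : AreSimilar Γ Γ') {R : ℂ ≃ᵢ ℂ}
    (hR : R '' Γ = Γ) : ∃ (S : ℂ ≃ᵢ ℂ), S '' Γ' = Γ' ∧ ∀ j : ℕ, S^[j] = id → R^[j] = id := by
  obtain ⟨Φ, rfl⟩ := h
  let S : ℂ ≃ᵢ ℂ := IsometryEquiv.mk' (fun z => Φ (R (Φ.symm z))) (fun z => Φ (R.symm (Φ.symm z)))
    (fun z => by simp) (Isometry.of_dist_eq fun x y => by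
      rw [Dilation.dist_eq, R.dist_eq, ← Dilation.dist_eq, Φ.apply_symm_apply,
        Φ.apply_symm_apply])
  have hS : ∀ z, S (Φ z) = Φ (R z) := fun z => by
    change Φ (R (Φ.symm (Φ z))) = _
    simp
  refine ⟨S, ?_, fun j hj => funext fun z => ?_⟩
  · rw [← Set.image_comp]
    have : (S ∘ Φ) = Φ ∘ R := funext hS
    rw [this, Set.image_comp, hR]
  · have h1 : Function.Semiconj Φ R S := fun z => (hS z).symm
    have h2 := h1.iterate_right j z
    rw [hj] at h2
    exact Φ.injective h2

theorem exp_angle_eq_inv (m : ℕ) : Complex.exp ((2 * -(Real.pi / m) : ℝ) * Complex.I) =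
    (Complex.exp (2 * Real.pi * Complex.I / m))⁻¹ := by
  rw [← Complex.exp_neg]
  congr 1
  push_cast
  ring

theorem isPrimitiveRoot_exp_angle {m : ℕ} (hm : m ≠ 0) :
    IsPrimitiveRoot (Complex.exp ((2 * -(Real.pi / m) : ℝ) * Complex.I)) m := by
  rw [exp_angle_eq_inv]
  exact (Complex.isPrimitiveRoot_exp m hm).inv

theorem circle_exp_eq_zpow (m : ℕ) : (Circle.exp (2 * Real.pi / m) : ℂ) =
    Complex.exp ((2 * -(Real.pi / m) : ℝ) * Complex.I) ^ (-1 : ℤ) := by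
  rw [exp_angle_eq_inv, zpow_neg_one, inv_inv, Circle.coe_exp]
  congr 1
  push_cast
  ring

open Topology in
theorem exists_profile_of_large : ∃ m₀ : ℕ, 1 < m₀ ∧ ∀ m : ℕ, m₀ < m →
    ∃ (γ : ℝ → ℂ) (θ k a : ℝ → ℝ) (σ l : ℝ), IsProfile γ θ k a σ l (-(Real.pi / m)) := by
  have hpi : Filter.Tendsto (fun m : ℕ => Real.pi / m) Filter.atTop (𝓝 0) :=
    tendsto_const_div_atTop_nhds_zero_nat _
  have htend : Filter.Tendsto (fun m : ℕ => Real.sin (Real.pi / m)) Filter.atTop (𝓝[>] 0) := by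
    refine tendsto_nhdsWithin_iff.2 ⟨?_, ?_⟩
    · simpa [Function.comp_def] using (Real.continuous_sin.tendsto 0).comp hpi
    · filter_upwards [Filter.eventually_gt_atTop 1] with m hm
      have hm' : (1 : ℝ) < m := by exact_mod_cast hm
      exact Real.sin_pos_of_pos_of_lt_pi (by positivity) (div_lt_self Real.pi_pos hm')
  obtain ⟨m₁, hm₁⟩ := Filter.eventually_atTop.1 (htend.eventually eventually_exists_half_period)
  refine ⟨max m₁ 2, lt_max_of_lt_right one_lt_two, fun m hm => ?_⟩
  obtain ⟨p, l, hp1, hp2, hl, hbd, hu, ha, hv, hpos, hsmall, hsin⟩ :=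
    hm₁ m ((le_max_left _ _).trans hm.le)
  have hm2 : (2 : ℝ) ≤ m := by exact_mod_cast (le_max_right m₁ 2).trans hm.le
  have hpi3 := Real.pi_gt_three
  have hle : Real.pi / m ≤ Real.pi / 2 :=
    div_le_div_of_nonneg_left Real.pi_pos.le two_pos hm2
  have hnn : 0 ≤ Real.pi / m := by positivity
  have habs := abs_lt.1 hsmall
  have hΘ : ∫ s in 0..l, trajectory p s 2 = -(Real.pi / m) := by
    -- The bound `|Θ| < 1 < π / 2` selects the branch on which `sin Θ = -sin (π / m)` determines
    -- `Θ`.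
    refine Real.injOn_sin ⟨by linarith, by linarith⟩ ⟨by linarith, by linarith⟩ ?_
    rw [hsin, Real.sin_neg]
  obtain ⟨γ, θ, k, a, σ, h⟩ := exists_isProfile hp1 hp2 hl hbd hu ha hv hpos
  rw [hΘ] at h
  exact ⟨γ, θ, k, a, σ, l, h⟩

/-- The rotation of order `m` would be conjugate to a symmetry of the second image, whose `m'`-th or
second iterate is the identity. Both exponents are positive and smaller than `m`. -/
theorem IsProfile.not_areSimilar {γ γ' : ℝ → ℂ} {θ θ' k k' a a' : ℝ → ℝ} {σ σ' l l' : ℝ} {m m' : ℕ}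
    (h : IsProfile γ θ k a σ l (-(Real.pi / m))) (h' : IsProfile γ' θ' k' a' σ' l' (-(Real.pi / m')))
    (hm' : 1 < m') (hmm : m' < m) : ¬ AreSimilar (Set.range γ) (Set.range γ') := by
  intro hsim
  have hprim := isPrimitiveRoot_exp_angle (m := m) (by omega)
  obtain ⟨S, hS, hSR⟩ := hsim.exists_conj (h.rotation_image_range (circle_exp_eq_zpow m))
  have hiter : ∀ j : ℕ, 0 < j → j < m → ¬
      ((rotation (Circle.exp (2 * Real.pi / m))).toIsometryEquiv : ℂ → ℂ)^[j] = id := by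
    intro j hj hjm hid
    have h1 : ∀ j : ℕ, (rotation (Circle.exp (2 * Real.pi / m))).toIsometryEquiv^[j] 1 =
        (Circle.exp (2 * Real.pi / m) : ℂ) ^ j := by
      intro j
      induction j with
      | zero => simp
      | succ j ih =>
        rw [Function.iterate_succ_apply', ih, pow_succ']
        simp
    have h2 := h1 j
    rw [hid, id, circle_exp_eq_zpow, zpow_neg_one, inv_pow, eq_comm, inv_eq_one] at h2
    exact absurd (Nat.le_of_dvd hj (hprim.dvd_of_pow_eq_one j h2)) (by omega)
  rcases h'.iterate_eq_of_image_eq hm' (isPrimitiveRoot_exp_angle (by omega)) hS with hj | hj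
  · exact hiter m' (by omega) hmm (hSR _ hj)
  · exact hiter 2 (by omega) (by omega) (hSR _ hj)

theorem theorem1 :
    ∃ (m₀ : ℕ) (γ : ℕ → ℝ → ℂ),
      (∀ m : ℕ, m₀ < m →
        IsSmoothClosedImmersedCurve (γ m) ∧
        IsHomotheticExpander (γ m) ∧
        HasDihedralSymmetry m (Set.range (γ m))) ∧
      ∀ m m' : ℕ, m₀ < m → m₀ < m' → m ≠ m' →
        ¬ AreSimilar (Set.range (γ m)) (Set.range (γ m')) := by
  obtain ⟨m₀, hm₀, hprof⟩ := exists_profile_of_large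
  have hex : ∀ m : ℕ, ∃ γ : ℝ → ℂ, m₀ < m →
      ∃ (θ k a : ℝ → ℝ) (σ l : ℝ), IsProfile γ θ k a σ l (-(Real.pi / m)) := fun m => by
    by_cases hm : m₀ < m
    · obtain ⟨γ, hγ⟩ := hprof m hm
      exact ⟨γ, fun _ => hγ⟩
    -- For `m ≤ m₀` the value is arbitrary.
    · exact ⟨0, fun h => absurd h hm⟩
  choose γ hγ using hex
  refine ⟨m₀, γ, fun m hm => ?_, fun m m' hm hm' hne => ?_⟩
  · obtain ⟨θ, k, a, σ, l, h⟩ := hγ m hm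
    have hprim := isPrimitiveRoot_exp_angle (m := m) (by omega)
    exact ⟨h.isSmoothClosedImmersedCurve (by omega) hprim.pow_eq_one,
      h.isHomotheticExpander (by omega) hprim.pow_eq_one,
      h.hasDihedralSymmetry (by omega) hprim (circle_exp_eq_zpow m)⟩
  · obtain ⟨θ, k, a, σ, l, h⟩ := hγ m hm
    obtain ⟨θ', k', a', σ', l', h'⟩ := hγ m' hm'
    rcases hne.lt_or_gt with hlt | hlt
    · exact fun hsim => h'.not_areSimilar h (by omega) hlt hsim.symm
    · exact h.not_areSimilar h' (by omega) hlt
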